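/- For $a,b\in\mathbb R^3$ let $a\wedge b$ be the vector product, let $|\cdot|$ be the Euclidean norm, and let $H^1(\mathbb R^2,\mathbb R^3)$ be the space of functions in $L^2(\mathbb R^2,\mathbb R^3)$ whose weak first partial derivatives are in $L^2$. For $w\in H^1(\mathbb R^2,\mathbb R^3)$ put $$\|\nabla w\|_2=\Big(\int_{\mathbb R^2}\big(|w_x|^2+|w_y|^2\big)\,dx\,dy\Big)^{1/2},\qquad \operatorname{osc}(w)=\operatorname*{ess\,sup}_{(z,z')\in\mathbb R^2\times\mathbb R^2}|w(z)-w(z')|\in[0,\infty],$$ so that $\operatorname{osc}(w)=\sup_{z,z'}|w(z)-w(z')|$ if $w$ is continuous. Let $v,u\in H^1(\mathbb R^2,\mathbb R^3)$ be such that $$\Delta u=-2\,v_x\wedge v_y\quad\text{on }\mathbb R^2$$ in the sense of distributions. Then $$\operatorname{osc}(u)+\|\nabla u\|_2\le\left(\frac1\pi+\sqrt{\frac{3}{8\pi}}\right)\|\nabla v\|_2^2 .$$ In particular $\operatorname{osc}(u)<\infty$. -/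

import Mathlib

open MeasureTheory
open scoped ENNReal ContDiff

namespace Wente

/-- The plane `ℝ²` with its Euclidean norm; coordinate `0` is `x`, coordinate `1` is `y`. -/
abbrev R2 : Type := EuclideanSpace ℝ (Fin 2)

/-- The space `ℝ³` with its Euclidean norm. -/
abbrev R3 : Type := EuclideanSpace ℝ (Fin 3)

/-- The vector product `a ∧ b` of `ℝ³`. -/
def wedge (a b : R3) : R3 := WithLp.toLp 2 (crossProduct a.ofLp b.ofLp)

/-- `φ` is a test function on `ℝ²`: smooth with compact support. -/
def IsTest (φ : R2 → ℝ) : Prop := ContDiff ℝ ∞ φ ∧ HasCompactSupport φ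

/-- The partial derivative in the coordinate direction `i` of a test function. -/
noncomputable def partialDeriv (i : Fin 2) (φ : R2 → ℝ) (z : R2) : ℝ :=
  fderiv ℝ φ z (EuclideanSpace.single i 1)

/-- `g` is a weak (distributional) partial derivative of `u` in the coordinate direction `i`. -/
def HasWeakPartial (i : Fin 2) (u g : R2 → R3) : Prop :=
  LocallyIntegrable u ∧ LocallyIntegrable g ∧
    ∀ φ : R2 → ℝ, IsTest φ → ∫ z, partialDeriv i φ z • u z = -∫ z, φ z • g z

/-- The Sobolev space `H¹(ℝ², ℝ³)`: square integrable functions whose weak first derivatives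
exist and are square integrable. -/
def MemH1 (u : R2 → R3) : Prop :=
  MemLp u 2 ∧ ∀ i : Fin 2, ∃ g : R2 → R3, HasWeakPartial i u g ∧ MemLp g 2

open Classical in
/-- The weak partial derivative of `u` in the coordinate direction `i` (unique almost everywhere;
`0` if there is none). -/
noncomputable def weakPartial (i : Fin 2) (u : R2 → R3) : R2 → R3 :=
  if h : ∃ g, HasWeakPartial i u g then h.choose else 0

/-- The pointwise norm `|∇u| = (|u_x|² + |u_y|²)^{1/2}` of the weak gradient. -/
noncomputable def gradNorm (u : R2 → R3) (z : R2) : ℝ :=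
  √(‖weakPartial 0 u z‖ ^ 2 + ‖weakPartial 1 u z‖ ^ 2)

/-- `u` solves `Δu = -2 v_x ∧ v_y` on `ℝ²` in the sense of distributions. -/
def IsSolution (u v : R2 → R3) : Prop :=
  ∀ φ : R2 → ℝ, IsTest φ →
    ∫ z, Laplacian.laplacian φ z • u z =
      ∫ z, φ z • ((-2 : ℝ) • wedge (weakPartial 0 v z) (weakPartial 1 v z))

/-- The oscillation `sup_{z,w} |u(z) - u(w)|` of a function that is defined almost everywhere:
the supremum is the essential one, over pairs of points. -/
noncomputable def osc (u : R2 → R3) : ℝ≥0∞ :=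
  essSup (fun p : R2 × R2 => ‖u p.1 - u p.2‖ₑ) (volume.prod volume)

/-- On continuous functions `osc` is the usual supremum over all pairs of points. -/
theorem osc_eq_iSup {u : R2 → R3} (hu : Continuous u) :
    osc u = ⨆ (z : R2) (w : R2), ‖u z - u w‖ₑ := by
  have hc : Continuous fun p : R2 × R2 => ‖u p.1 - u p.2‖ₑ := by fun_prop
  rw [← iSup_prod (f := fun p : R2 × R2 => ‖u p.1 - u p.2‖ₑ)]
  apply le_antisymm
  · exact essSup_le_of_ae_le _ (Filter.Eventually.of_forall fun p => le_iSup
      (fun p : R2 × R2 => ‖u p.1 - u p.2‖ₑ) p)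
  · refine iSup_le fun p => ?_
    by_contra! hp
    have hopen : IsOpen {q : R2 × R2 | osc u < ‖u q.1 - u q.2‖ₑ} :=
      isOpen_lt continuous_const hc
    have hpos := hopen.measure_pos (volume.prod volume) ⟨p, hp⟩
    exact hpos.ne' (meas_essSup_lt (f := fun p : R2 × R2 => ‖u p.1 - u p.2‖ₑ))

theorem HasWeakPartial.ae_eq {i : Fin 2} {u g h : R2 → R3} (hg : HasWeakPartial i u g)
    (hh : HasWeakPartial i u h) : g =ᵐ[volume] h := by
  refine ae_eq_of_integral_contDiff_smul_eq hg.2.1 hh.2.1 fun φ h1 h2 => ?_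
  have a := hg.2.2 φ ⟨h1, h2⟩
  have b := hh.2.2 φ ⟨h1, h2⟩
  exact neg_injective (a.symm.trans b)

theorem MemH1.hasWeakPartial {u : R2 → R3} (hu : MemH1 u) (i : Fin 2) :
    HasWeakPartial i u (weakPartial i u) := by
  obtain ⟨g, hg, -⟩ := hu.2 i
  have h : ∃ g, HasWeakPartial i u g := ⟨g, hg⟩
  rw [weakPartial, dif_pos h]
  exact h.choose_spec

theorem MemH1.memLp_weakPartial {u : R2 → R3} (hu : MemH1 u) (i : Fin 2) :
    MemLp (weakPartial i u) 2 := by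
  obtain ⟨g, hg, hL⟩ := hu.2 i
  exact hL.ae_eq (hg.ae_eq (hu.hasWeakPartial i))

end Wente

/-! Write D = ∫ (|v_x|² + |v_y|²) and Q = ∫ |v_x ∧ v_y|. Everything rests on two bounds for ess sup
|u|, namely D/(2π) and (√3 D - 2Q)/(2π) (`IsSolution.ae_norm_le`). The first gives osc u ≤ D/π by
the triangle inequality. Testing the equation with smooth approximations of u that keep its sup
bound gives ∫ |∇u|² ≤ 2Q · ess sup |u| (`IsSolution.energy_le`). With the second bound, the product
(√3 D - 2Q) · 2Q is at most 3D²/4 whatever Q is, hence the constant √(3/(8π)).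

For the sup bounds, u(z) is Δu paired with log|x - z|/(2π). The Jacobian is a divergence, so its
derivatives can be moved to the kernel (`integral_smul_jacobian`). The kernel is radial, so only v ∧
v_θ survives, with a weight of size at most 1/(2πr²). On each circle about z, Wirtinger's inequality
gives |∫ v ∧ v_θ dθ| ≤ ∫ |v_θ|² dθ (`norm_integral_wedge_deriv_le`), and |v_θ|²/r² is bounded
pointwise both by |∇v|² and by √3 |∇v|² - 2|v_x ∧ v_y| (`norm_rot_sq_le'`, `norm_rot_sq_le`). These
bounds do not depend on how the logarithm is truncated.

The truncated logarithm `logKernel a b` is a test function whose Laplacian is a difference of two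
mollifiers of mass one (`laplacian_logKernel`). The inner one recovers u(z) at almost every z as a →
0; the outer one contributes nothing as b → ∞ because u is in L². The estimate passes from smooth v
to v in H¹ by density (`exists_smooth_approx`), since all the integrals involved are continuous
under L² convergence of gradients. -/

namespace Wente

/-! ### Vector product and pointwise estimates -/

/-- The vector product as a continuous bilinear map. -/
noncomputable def wedgeL : R3 →L[ℝ] R3 →L[ℝ] R3 :=
  LinearMap.mkContinuous₂
    (LinearMap.mk₂ ℝ wedge
      (fun a b c => by ext i; simp [wedge])
      (fun t a b => by ext i; simp [wedge])
      (fun a b c => by ext i; simp [wedge])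
      (fun t a b => by ext i; simp [wedge])) 1
    (fun a b => by
      simp only [LinearMap.mk₂_apply, one_mul]
      have h := InnerProductGeometry.norm_ofLp_crossProduct a b
      rw [wedge, h]
      exact mul_le_of_le_one_right (by positivity) (Real.sin_le_one _))

@[simp] theorem wedgeL_apply (a b : R3) : wedgeL a b = wedge a b := rfl

theorem norm_wedge_le (a b : R3) : ‖wedge a b‖ ≤ ‖a‖ * ‖b‖ := by
  rw [wedge, InnerProductGeometry.norm_ofLp_crossProduct a b]
  exact mul_le_of_le_one_right (by positivity) (Real.sin_le_one _)

theorem wedge_self (a : R3) : wedge a a = 0 := by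
  simp [wedge]

theorem wedge_swap (a b : R3) : wedge a b = -wedge b a := by
  rw [wedge, wedge, ← cross_anticomm]; rfl

theorem wedge_sub_left (a b c : R3) : wedge (a - b) c = wedge a c - wedge b c := by
  simp [← wedgeL_apply]

theorem wedge_sub_right (a b c : R3) : wedge a (b - c) = wedge a b - wedge a c := by
  simp [← wedgeL_apply]

theorem wedge_add_left (a b c : R3) : wedge (a + b) c = wedge a c + wedge b c := by
  simp [← wedgeL_apply]

theorem wedge_smul_left (t : ℝ) (a b : R3) : wedge (t • a) b = t • wedge a b := by
  simp [← wedgeL_apply]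

theorem wedge_smul_right (t : ℝ) (a b : R3) : wedge a (t • b) = t • wedge a b := by
  simp [← wedgeL_apply]

theorem continuous_wedge : Continuous fun p : R3 × R3 => wedge p.1 p.2 := by
  simp_rw [← wedgeL_apply]; fun_prop

/-- The pointwise estimate behind the constant `√(3 / (8π))`: for the vector `(x, y)`. -/
theorem norm_rot_sq_le (x y : ℝ) (p q : R3) :
    ‖x • q - y • p‖ ^ 2 ≤ (x ^ 2 + y ^ 2) *
      (√3 * (‖p‖ ^ 2 + ‖q‖ ^ 2) - 2 * ‖wedge p q‖) := by
  -- The best constant in |a|² + 2|a||b| ≤ c (|a|² + |b|²) is the golden ratio, about 1.618. The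
  -- rational 17/10 separates it from √3.
  have h3 : (17 / 10 : ℝ) ≤ √3 := by
    apply Real.le_sqrt_of_sq_le; norm_num
  -- If p and q are the partial derivatives, a and b are the angular and radial ones times r.
  -- Rotating the frame preserves both the energy and the vector product.
  set a := x • q - y • p with ha
  set b := x • p + y • q with hb
  have h1 : ‖a‖ ^ 2 + ‖b‖ ^ 2 = (x ^ 2 + y ^ 2) * (‖p‖ ^ 2 + ‖q‖ ^ 2) := by
    rw [ha, hb, norm_sub_sq_real, norm_add_sq_real, norm_smul, norm_smul, norm_smul, norm_smul,
      real_inner_smul_left, real_inner_smul_right, real_inner_smul_left, real_inner_smul_right,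
      real_inner_comm q p]
    simp only [mul_pow, Real.norm_eq_abs, sq_abs]
    ring
  have h2 : wedge b a = (x ^ 2 + y ^ 2) • wedge p q := by
    rw [ha, hb]
    simp only [wedge_sub_right, wedge_add_left, wedge_smul_left, wedge_smul_right, wedge_self,
      wedge_swap q p]
    module
  have h3' : (x ^ 2 + y ^ 2) * ‖wedge p q‖ ≤ ‖b‖ * ‖a‖ := by
    have := norm_wedge_le b a
    rwa [h2, norm_smul, Real.norm_of_nonneg (by positivity)] at this
  have : ‖a‖ ^ 2 + 2 * (‖b‖ * ‖a‖) ≤ √3 * (‖a‖ ^ 2 + ‖b‖ ^ 2) := by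
    have : ‖a‖ ^ 2 + 2 * (‖b‖ * ‖a‖) ≤ 17 / 10 * (‖a‖ ^ 2 + ‖b‖ ^ 2) := by
      nlinarith [sq_nonneg (7 * ‖a‖ - 10 * ‖b‖), sq_nonneg ‖b‖]
    exact this.trans (mul_le_mul_of_nonneg_right h3 (by positivity))
  nlinarith [h1]

theorem norm_rot_sq_le' (x y : ℝ) (p q : R3) :
    ‖x • q - y • p‖ ^ 2 ≤ (x ^ 2 + y ^ 2) * (‖p‖ ^ 2 + ‖q‖ ^ 2) := by
  have h1 : ‖x • q - y • p‖ ^ 2 + ‖x • p + y • q‖ ^ 2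
      = (x ^ 2 + y ^ 2) * (‖p‖ ^ 2 + ‖q‖ ^ 2) := by
    rw [norm_sub_sq_real, norm_add_sq_real, norm_smul, norm_smul, norm_smul, norm_smul,
      real_inner_smul_left, real_inner_smul_right, real_inner_smul_left, real_inner_smul_right,
      real_inner_comm q p]
    simp only [mul_pow, Real.norm_eq_abs, sq_abs]
    ring
  nlinarith [sq_nonneg ‖x • p + y • q‖]

/-! ### Wirtinger's inequality and closed curves -/

open Real in
/-- **Wirtinger's inequality** for real functions of period `2π`. -/
theorem integral_sq_le_integral_deriv_sq {f f' : ℝ → ℝ} (hf : ∀ t, HasDerivAt f (f' t) t)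
    (hf' : Continuous f') (hper : f π = f (-π)) (hmean : ∫ t in (-π)..π, f t = 0) :
    ∫ t in (-π)..π, f t ^ 2 ≤ ∫ t in (-π)..π, f' t ^ 2 := by
  have hab : -π < π := by linarith [pi_pos]
  have hfc : Continuous f := continuous_iff_continuousAt.2 fun t => (hf t).continuousAt
  have hL : ∀ g : ℝ → ℝ, Continuous g →
      MemLp (fun t => (g t : ℂ)) 2 (volume.restrict (Set.Ioc (-π) π)) := fun g hg => by
    have : IsFiniteMeasure (volume.restrict (Set.Ioc (-π) π)) := ⟨by simp⟩
    obtain ⟨C, hC⟩ := (isCompact_Icc (a := -π) (b := π)).exists_bound_of_continuousOn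
      (f := fun t => (g t : ℂ)) (by fun_prop)
    refine MemLp.of_bound (by fun_prop) C ?_
    filter_upwards [ae_restrict_mem measurableSet_Ioc] with t ht
    exact hC t (Set.Ioc_subset_Icc_self ht)
  have s1 := hasSum_sq_fourierCoeffOn hab (hL f hfc)
  have s2 := hasSum_sq_fourierCoeffOn hab (hL f' hf')
  -- By Parseval it suffices to compare coefficients: differentiation multiplies the n-th one by in,
  -- and the mean condition disposes of n = 0.
  have key : ∀ n : ℤ, ‖fourierCoeffOn hab (fun t => (f t : ℂ)) n‖ ^ 2 ≤
      ‖fourierCoeffOn hab (fun t => (f' t : ℂ)) n‖ ^ 2 := by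
    intro n
    rcases eq_or_ne n 0 with rfl | hn
    · have : fourierCoeffOn hab (fun t => (f t : ℂ)) 0 = 0 := by
        rw [fourierCoeffOn_eq_integral]
        simp [intervalIntegral.integral_ofReal, hmean]
      rw [this]; simp
    · have hI : IntervalIntegrable (fun t => (f' t : ℂ)) volume (-π) π :=
        (by fun_prop : Continuous fun t => (f' t : ℂ)).intervalIntegrable _ _
      rw [fourierCoeffOn_of_hasDerivAt hab hn (fun t _ => (hf t).ofReal_comp) hI]
      have h1 : (1 : ℝ) ≤ |(n : ℝ)| := by
        exact_mod_cast Int.one_le_abs hn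
      have hpi := pi_pos
      simp only [hper, sub_self, mul_zero, zero_sub, norm_mul, norm_neg, norm_div, norm_one,
        Complex.norm_ofNat, Complex.norm_I, Complex.norm_intCast, Complex.norm_real,
        Real.norm_eq_abs, abs_of_pos hpi]
      gcongr
      have : ‖(π : ℂ) - ((-π : ℝ) : ℂ)‖ = 2 * π := by
        rw [← Complex.ofReal_sub, Complex.norm_real, Real.norm_eq_abs, abs_of_pos (by linarith)]
        ring
      rw [this, ← mul_assoc]
      apply mul_le_of_le_one_left (norm_nonneg _)
      rw [div_mul_eq_mul_div, one_mul, mul_one]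
      exact div_le_one_of_le₀ (by nlinarith) (by positivity)
  have := hasSum_le key s1 s2
  simp only [Complex.norm_real, Real.norm_eq_abs, sq_abs, smul_eq_mul] at this
  exact le_of_mul_le_mul_left this (by positivity)

open Real in
/-- **Isoperimetric inequality** in its Fourier form for closed curves in `ℝ³`. -/
theorem norm_integral_wedge_deriv_le {w w' : ℝ → R3} (hw : ∀ t, HasDerivAt w (w' t) t)
    (hw' : Continuous w') (hper : w π = w (-π)) :
    ‖∫ t in (-π)..π, wedge (w t) (w' t)‖ ≤ ∫ t in (-π)..π, ‖w' t‖ ^ 2 := by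
  have hab : -π ≤ π := by linarith [pi_pos]
  have hwc : Continuous w := continuous_iff_continuousAt.2 fun t => (hw t).continuousAt
  -- Subtracting the mean c makes Wirtinger applicable and does not change the integral, since w'
  -- integrates to zero over a closed curve.
  set c : R3 := (2 * π)⁻¹ • ∫ t in (-π)..π, w t with hc
  have hII : ∀ {F : Type} [NormedAddCommGroup F] (g : ℝ → F), Continuous g →
    IntervalIntegrable g volume (-π) π := fun g hg => hg.intervalIntegrable _ _
  have h0 : ∫ t in (-π)..π, w' t = 0 := by
    rw [intervalIntegral.integral_eq_sub_of_hasDerivAt (fun t _ => hw t) (hII _ hw'), hper, sub_self]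
  have hmean : ∫ t in (-π)..π, (w t - c) = 0 := by
    rw [intervalIntegral.integral_sub (hII _ hwc) (hII _ continuous_const),
      intervalIntegral.integral_const, hc, smul_smul]
    rw [show (π - -π) * (2 * π)⁻¹ = 1 by field_simp; ring, one_smul, sub_self]
  have hcont1 : Continuous fun t => wedge (w t - c) (w' t) :=
    continuous_wedge.comp (by fun_prop : Continuous fun t => (w t - c, w' t))
  have hcont2 : Continuous fun t => wedgeL c (w' t) := by fun_prop
  have h1 : ∫ t in (-π)..π, wedge (w t) (w' t) = ∫ t in (-π)..π, wedge (w t - c) (w' t) := by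
    have : ∀ t, wedge (w t) (w' t) = wedge (w t - c) (w' t) + wedgeL c (w' t) := fun t => by
      rw [wedge_sub_left, wedgeL_apply, sub_add_cancel]
    simp_rw [this]
    rw [intervalIntegral.integral_add (hII _ hcont1) (hII _ hcont2),
      ContinuousLinearMap.intervalIntegral_comp_comm _ (hII _ hw'), h0, map_zero, add_zero]
  have hcoord : ∀ i : Fin 3, ∫ t in (-π)..π, (w t - c) i ^ 2 ≤ ∫ t in (-π)..π, (w' t i) ^ 2 := by
    intro i
    have hpr : ∀ t, HasDerivAt (fun t => (w t - c) i) (w' t i) t := fun t =>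
      ((EuclideanSpace.proj (𝕜 := ℝ) i).hasFDerivAt.comp_hasDerivAt t ((hw t).sub_const c))
    refine integral_sq_le_integral_deriv_sq hpr (by fun_prop) (by simp [hper]) ?_
    have := ContinuousLinearMap.intervalIntegral_comp_comm (EuclideanSpace.proj (𝕜 := ℝ) i)
      (hII (fun t => w t - c) (by fun_prop))
    rw [hmean, map_zero] at this
    exact this
  have h2 : ∫ t in (-π)..π, ‖w t - c‖ ^ 2 ≤ ∫ t in (-π)..π, ‖w' t‖ ^ 2 := by
    simp_rw [EuclideanSpace.real_norm_sq_eq]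
    rw [intervalIntegral.integral_finsetSum (fun i _ => hII _ (by fun_prop)),
      intervalIntegral.integral_finsetSum (fun i _ => hII _ (by fun_prop))]
    exact Finset.sum_le_sum fun i _ => hcoord i
  rw [h1]
  calc ‖∫ t in (-π)..π, wedge (w t - c) (w' t)‖
      ≤ ∫ t in (-π)..π, ‖wedge (w t - c) (w' t)‖ :=
        intervalIntegral.norm_integral_le_integral_norm hab
    _ ≤ ∫ t in (-π)..π, (1 / 2 * ‖w t - c‖ ^ 2 + 1 / 2 * ‖w' t‖ ^ 2) := by
        refine intervalIntegral.integral_mono_on hab (hII _ hcont1.norm)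
          (hII _ (by fun_prop)) fun t _ => ?_
        nlinarith [norm_wedge_le (w t - c) (w' t), sq_nonneg (‖w t - c‖ - ‖w' t‖)]
    _ ≤ ∫ t in (-π)..π, ‖w' t‖ ^ 2 := by
        rw [intervalIntegral.integral_add (hII _ (by fun_prop)) (hII _ (by fun_prop)),
          intervalIntegral.integral_const_mul, intervalIntegral.integral_const_mul]
        linarith

/-! ### Partial derivatives and the Jacobian as a divergence -/

/-- The partial derivative in the coordinate direction `i`. -/
noncomputable def pd {F : Type*} [NormedAddCommGroup F] [NormedSpace ℝ F] (i : Fin 2) (w : R2 → F)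
    (z : R2) : F :=
  fderiv ℝ w z (EuclideanSpace.single i 1)

section pd
variable {F : Type*} [NormedAddCommGroup F] [NormedSpace ℝ F]

theorem _root_.ContDiff.pd {w : R2 → F} {m n : WithTop ℕ∞} (hw : ContDiff ℝ n w) (i : Fin 2)
    (hmn : m + 1 ≤ n) : ContDiff ℝ m (pd i w) :=
  (hw.fderiv_right hmn).clm_apply contDiff_const

theorem _root_.HasCompactSupport.pd {w : R2 → F} (hw : HasCompactSupport w) (i : Fin 2) :
    HasCompactSupport (pd i w) := by
  refine (hw.fderiv ℝ).mono fun x hx => ?_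
  contrapose! hx
  simp_all [Wente.pd]

theorem fderiv_apply_eq (w : R2 → F) (z h : R2) :
    fderiv ℝ w z h = h 0 • pd 0 w z + h 1 • pd 1 w z := by
  have : h = h 0 • EuclideanSpace.single 0 1 + h 1 • EuclideanSpace.single 1 1 := by
    ext i; fin_cases i <;> simp
  conv_lhs => rw [this]
  simp [pd]

theorem pd_comm {w : R2 → F} (hw : ContDiff ℝ 2 w) (i j : Fin 2) (z : R2) :
    pd i (pd j w) z = pd j (pd i w) z := by
  have hd : DifferentiableAt ℝ (fderiv ℝ w) z :=
    (hw.fderiv_right (m := 1) (by norm_num)).differentiable (by norm_num) z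
  have h (a b : Fin 2) : pd a (pd b w) z =
      fderiv ℝ (fderiv ℝ w) z (EuclideanSpace.single a 1) (EuclideanSpace.single b 1) := by
    have := (hd.hasFDerivAt.clm_apply
      (hasFDerivAt_const (EuclideanSpace.single b (1 : ℝ)) z)).fderiv
    change fderiv ℝ (fun y => fderiv ℝ w y (EuclideanSpace.single b 1)) z _ = _
    rw [this]; simp
  rw [h, h]
  exact (hw.contDiffAt.isSymmSndFDerivAt (by simp)) _ _

theorem pd_smul {f : R2 → ℝ} {w : R2 → F} {z : R2} (hf : DifferentiableAt ℝ f z)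
    (hw : DifferentiableAt ℝ w z) (i : Fin 2) :
    pd i (fun x => f x • w x) z = f z • pd i w z + pd i f z • w z := by
  simp [pd, fderiv_fun_smul hf hw]

theorem pd_wedge {a b : R2 → R3} {z : R2} (ha : DifferentiableAt ℝ a z)
    (hb : DifferentiableAt ℝ b z) (i : Fin 2) :
    pd i (fun x => wedge (a x) (b x)) z = wedge (a z) (pd i b z) + wedge (pd i a z) (b z) := by
  have := (wedgeL.hasFDerivAt_of_bilinear ha.hasFDerivAt hb.hasFDerivAt).fderiv
  simp only [wedgeL_apply] at this
  rw [pd, this]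
  simp [pd]

theorem integral_smul_pd {f : R2 → ℝ} {w : R2 → F} (hf : ContDiff ℝ 1 f) (hw : ContDiff ℝ 1 w)
    (hc : HasCompactSupport f ∨ HasCompactSupport w) (i : Fin 2) :
    ∫ x, f x • pd i w x = -∫ x, pd i f x • w x := by
  have hf' : Continuous (pd i f) := (hf.pd (m := 0) i (by simp)).continuous
  have hw' : Continuous (pd i w) := (hw.pd (m := 0) i (by simp)).continuous
  have hfc := hf.continuous
  have hwc := hw.continuous
  refine integral_smul_fderiv_eq_neg_fderiv_smul_of_integrable ?_ ?_ ?_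
    (fun x _ => hf.differentiable (by norm_num) x) (fun x _ => hw.differentiable (by norm_num) x)
  · refine (hf'.smul hwc).integrable_of_hasCompactSupport ?_
    rcases hc with h | h
    · exact (h.pd i).smul_right
    · exact h.smul_left
  · refine (hfc.smul hw').integrable_of_hasCompactSupport ?_
    rcases hc with h | h
    · exact h.smul_right
    · exact (h.pd i).smul_left
  · refine (hfc.smul hwc).integrable_of_hasCompactSupport ?_
    rcases hc with h | h
    · exact h.smul_right
    · exact h.smul_left

end pd

/-- Integration by parts for the Jacobian `2 v_x ∧ v_y`. -/
theorem integral_smul_jacobian {φ : R2 → ℝ} {v : R2 → R3} (hφ : ContDiff ℝ 1 φ)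
    (hv : ContDiff ℝ 2 v) (hc : HasCompactSupport v) :
    ∫ x, φ x • ((2 : ℝ) • wedge (pd 0 v x) (pd 1 v x)) =
      -∫ x, wedge (v x) (pd 0 φ x • pd 1 v x - pd 1 φ x • pd 0 v x) := by
  have hv1 : ContDiff ℝ 1 v := hv.of_le (by norm_num)
  have hd (i) : ContDiff ℝ 1 (pd i v) := hv.pd i (by norm_num)
  have hW (i) : ContDiff ℝ 1 fun x => wedge (v x) (pd i v x) := by
    have : ContDiff ℝ 1 fun x => wedgeL (v x) (pd i v x) := by
      have := hd i; fun_prop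
    exact this
  have hWc (i) : HasCompactSupport fun x => wedge (v x) (pd i v x) := by
    refine hc.mono fun x hx => ?_
    contrapose! hx
    have : v x = 0 := by simpa using hx
    simp [this, ← wedgeL_apply]
  have hφ' (i) : Continuous (pd i φ) := (hφ.pd (m := 0) i (by simp)).continuous
  have hφc := hφ.continuous
  have e0 := integral_smul_pd hφ (hW 1) (Or.inr (hWc 1)) 0
  have e1 := integral_smul_pd hφ (hW 0) (Or.inr (hWc 0)) 1
  have hI (i j) : Integrable fun x => φ x • pd i (fun x => wedge (v x) (pd j v x)) x :=
    (hφc.smul ((hW j).pd (m := 0) i (by simp)).continuous).integrable_of_hasCompactSupport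
      ((hWc j).pd i).smul_left
  have hJ (i j) : Integrable fun x => pd i φ x • wedge (v x) (pd j v x) :=
    ((hφ' i).smul (hW j).continuous).integrable_of_hasCompactSupport (hWc j).smul_left
  -- 2 v_x ∧ v_y = ∂_x(v ∧ v_y) - ∂_y(v ∧ v_x): the mixed second derivatives cancel.
  have l : ∀ x, φ x • ((2 : ℝ) • wedge (pd 0 v x) (pd 1 v x)) =
      φ x • pd 0 (fun x => wedge (v x) (pd 1 v x)) x -
      φ x • pd 1 (fun x => wedge (v x) (pd 0 v x)) x := fun x => by
    have a := hv1.differentiable (by norm_num) x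
    have b (i) := (hd i).differentiable (by norm_num) x
    rw [pd_wedge a (b 1), pd_wedge a (b 0), pd_comm hv 1 0, wedge_swap (pd 1 v x)]
    module
  have r : ∀ x, wedge (v x) (pd 0 φ x • pd 1 v x - pd 1 φ x • pd 0 v x) =
      pd 0 φ x • wedge (v x) (pd 1 v x) - pd 1 φ x • wedge (v x) (pd 0 v x) := fun x => by
    rw [wedge_sub_right, wedge_smul_right, wedge_smul_right]
  simp_rw [l, r]
  rw [integral_sub (hI 0 1) (hI 1 0), integral_sub (hJ 0 1) (hJ 1 0), e0, e1]
  abel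

/-! ### Polar coordinates and the estimate on circles -/

/-- The point of the unit circle at the angle `θ`. -/
noncomputable def circ (θ : ℝ) : R2 := !₂[Real.cos θ, Real.sin θ]

/-- The unit tangent vector to the unit circle at the angle `θ`. -/
noncomputable def circ' (θ : ℝ) : R2 := !₂[-Real.sin θ, Real.cos θ]

theorem continuous_circ : Continuous circ := by unfold circ; fun_prop

theorem norm_circ (θ : ℝ) : ‖circ θ‖ = 1 := by
  simp [circ, EuclideanSpace.norm_eq, Fin.sum_univ_two]

theorem hasDerivAt_circ (θ : ℝ) : HasDerivAt circ (circ' θ) θ := by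
  have h : HasDerivAt (fun θ => ![Real.cos θ, Real.sin θ]) ![-Real.sin θ, Real.cos θ] θ := by
    rw [hasDerivAt_pi]
    intro i
    fin_cases i
    · simpa using Real.hasDerivAt_cos θ
    · simpa using Real.hasDerivAt_sin θ
  exact (PiLp.continuousLinearEquiv 2 ℝ fun _ : Fin 2 => ℝ).symm.hasFDerivAt.comp_hasDerivAt θ h

/-- Polar coordinates about a point of the plane. -/
theorem integral_polar {F : Type*} [NormedAddCommGroup F] [NormedSpace ℝ F] (f : R2 → F)
    (z : R2) :
    ∫ x, f x = ∫ p in Set.Ioi (0 : ℝ) ×ˢ Set.Ioo (-Real.pi) Real.pi,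
      p.1 • f (z + p.1 • circ p.2) := by
  have hm := (PiLp.volume_preserving_toLp (Fin 2)).comp
    (volume_preserving_finTwoArrow ℝ).symm
  have he : MeasurableEmbedding ((WithLp.toLp 2 : (Fin 2 → ℝ) → R2) ∘
      (MeasurableEquiv.finTwoArrow (α := ℝ)).symm) :=
    (MeasurableEquiv.toLp 2 (Fin 2 → ℝ)).measurableEmbedding.comp
      (MeasurableEquiv.finTwoArrow (α := ℝ)).symm.measurableEmbedding
  rw [← integral_add_left_eq_self f z, ← hm.integral_comp he, ← integral_comp_polarCoord_symm]
  refine setIntegral_congr_fun polarCoord.open_target.measurableSet fun p _ => ?_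
  simp only [Function.comp]
  congr 3
  ext i
  fin_cases i <;> simp [circ, polarCoord, MeasurableEquiv.finTwoArrow]

/-- Polar coordinates about a point, as an iterated integral. -/
theorem integral_polar_iterated {F : Type*} [NormedAddCommGroup F] [NormedSpace ℝ F]
    {f : R2 → F} (hf : Continuous f) (hc : HasCompactSupport f) (z : R2) :
    (IntegrableOn (fun r : ℝ => ∫ θ in (-Real.pi)..Real.pi, r • f (z + r • circ θ)) (Set.Ioi 0)) ∧
    ∫ x, f x = ∫ r in Set.Ioi (0 : ℝ), ∫ θ in (-Real.pi)..Real.pi, r • f (z + r • circ θ) := by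
  have hpi : -Real.pi ≤ Real.pi := by linarith [Real.pi_pos]
  have hcont : Continuous fun p : ℝ × ℝ => p.1 • f (z + p.1 • circ p.2) := by
    have := continuous_circ; fun_prop
  obtain ⟨R, hR⟩ := hc.isCompact.isBounded.subset_closedBall z
  have hI : IntegrableOn (fun p : ℝ × ℝ => p.1 • f (z + p.1 • circ p.2))
      (Set.Ioi (0 : ℝ) ×ˢ Set.Ioo (-Real.pi) Real.pi) := by
    have hK : IntegrableOn (fun p : ℝ × ℝ => p.1 • f (z + p.1 • circ p.2))
      (Set.Icc (0 : ℝ) R ×ˢ Set.Icc (-Real.pi) Real.pi) :=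
      hcont.continuousOn.integrableOn_compact (isCompact_Icc.prod isCompact_Icc)
    refine hK.of_forall_sdiff_eq_zero (measurableSet_Ioi.prod measurableSet_Ioo) ?_
    rintro ⟨r, θ⟩ ⟨⟨h1, h2⟩, h3⟩
    have hr : R < r := by
      by_contra! h
      exact h3 ⟨⟨le_of_lt h1, h⟩, Set.Ioo_subset_Icc_self h2⟩
    have : f (z + r • circ θ) = 0 := by
      by_contra h
      have := hR (subset_tsupport f h)
      simp only [Metric.mem_closedBall, dist_eq_norm, add_sub_cancel_left, norm_smul, norm_circ,
        mul_one, Real.norm_eq_abs] at this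
      exact absurd ((le_abs_self r).trans this) (not_le.2 hr)
    simp [this]
  have hset (r : ℝ) : ∫ θ in (-Real.pi)..Real.pi, r • f (z + r • circ θ) =
      ∫ θ in Set.Ioo (-Real.pi) Real.pi, r • f (z + r • circ θ) := by
    rw [intervalIntegral.integral_of_le hpi, integral_Ioc_eq_integral_Ioo]
  simp_rw [hset]
  refine ⟨?_, ?_⟩
  · have := hI
    rw [IntegrableOn, Measure.volume_eq_prod, ← Measure.prod_restrict] at this
    exact this.integral_prod_left
  · rw [integral_polar f z, Measure.volume_eq_prod, setIntegral_prod _ (by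
      rwa [← Measure.volume_eq_prod])]

/-- The derivative of `w` in the angular direction about `z`. -/
noncomputable def angular (w : R2 → R3) (z x : R2) : R3 :=
  (x - z) 0 • pd 1 w x - (x - z) 1 • pd 0 w x

/-- By the chain rule, this makes `angular` the θ-derivative of w along the circle of radius r about
z. -/
theorem angular_polar (w : R2 → R3) (z : R2) (r θ : ℝ) :
    angular w z (z + r • circ θ) = r • fderiv ℝ w (z + r • circ θ) (circ' θ) := by
  rw [angular, fderiv_apply_eq]
  simp [circ, circ']
  module

/-- Circle by circle, the isoperimetric inequality bounds the integral of `v ∧ v_θ`. -/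
theorem norm_integral_smul_wedge_angular_le {c : ℝ → ℝ} (hc : Continuous c) {v : R2 → R3}
    (hv : ContDiff ℝ 1 v) (hcs : HasCompactSupport v) (z : R2) :
    ‖∫ x, c (‖x - z‖ ^ 2) • wedge (v x) (angular v z x)‖ ≤
      ∫ x, |c (‖x - z‖ ^ 2)| * ‖angular v z x‖ ^ 2 := by
  have hpi : -Real.pi ≤ Real.pi := by linarith [Real.pi_pos]
  have hvc := hv.continuous
  have hp (i) : Continuous (pd i v) := (hv.pd (m := 0) i (by simp)).continuous
  have hac : Continuous (angular v z) := by
    have h0 := hp 0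
    have h1 := hp 1
    unfold angular; fun_prop
  have hacs : HasCompactSupport (angular v z) := by
    refine (hcs.fderiv ℝ).mono fun x hx => ?_
    contrapose! hx
    have : fderiv ℝ v x = 0 := by simpa using hx
    simp [angular, pd, this]
  have hW : Continuous fun x => wedge (v x) (angular v z x) := continuous_wedge.comp (hvc.prodMk hac)
  obtain ⟨i1, e1⟩ := integral_polar_iterated (f := fun x => c (‖x - z‖ ^ 2) •
    wedge (v x) (angular v z x)) (by fun_prop) (by
      refine hcs.mono fun x hx => ?_
      contrapose! hx
      have : v x = 0 := by simpa using hx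
      simp [this, ← wedgeL_apply]) z
  obtain ⟨i2, e2⟩ := integral_polar_iterated (f := fun x => |c (‖x - z‖ ^ 2)| *
    ‖angular v z x‖ ^ 2) (by fun_prop) (by
      refine hacs.mono fun x hx => ?_
      contrapose! hx
      have : angular v z x = 0 := by simpa using hx
      simp [this]) z
  rw [e1, e2]
  refine (norm_integral_le_integral_norm _).trans ?_
  -- The radial weight is constant on each circle, so the inequality for closed curves can be
  -- applied for each r separately.
  refine setIntegral_mono_on i1.norm i2 measurableSet_Ioi fun r hr => ?_
  have hr0 : (0 : ℝ) ≤ r := le_of_lt hr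
  have hn (θ : ℝ) : ‖z + r • circ θ - z‖ ^ 2 = r ^ 2 := by
    rw [add_sub_cancel_left, norm_smul, norm_circ]; simp
  have hw (θ : ℝ) : HasDerivAt (fun θ => v (z + r • circ θ)) (angular v z (z + r • circ θ)) θ := by
    rw [angular_polar, ← map_smul]
    have := (hv.differentiable (by norm_num) (z + r • circ θ)).hasFDerivAt.comp_hasDerivAt θ
      (((hasDerivAt_circ θ).const_smul r).const_add z)
    exact this
  have hcirc : circ Real.pi = circ (-Real.pi) := by simp [circ]
  have := norm_integral_wedge_deriv_le hw (by have := continuous_circ; fun_prop)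
    (by rw [hcirc])
  simp only [hn]
  simp only [smul_smul, smul_eq_mul, ← mul_assoc]
  rw [intervalIntegral.integral_smul, intervalIntegral.integral_const_mul, norm_smul, norm_mul,
    Real.norm_of_nonneg hr0, Real.norm_eq_abs]
  gcongr

/-! ### Radial functions and the potential estimate for smooth maps -/

theorem laplacian_eq_sum_pd {φ : R2 → ℝ} (hφ : ContDiff ℝ 2 φ) (z : R2) :
    Laplacian.laplacian φ z = ∑ i, pd i (pd i φ) z := by
  have hd : DifferentiableAt ℝ (fderiv ℝ φ) z :=
    (hφ.fderiv_right (m := 1) (by norm_num)).differentiable (by norm_num) z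
  rw [InnerProductSpace.laplacian_eq_iteratedFDeriv_orthonormalBasis φ
    (EuclideanSpace.basisFun (Fin 2) ℝ)]
  refine Finset.sum_congr rfl fun i _ => ?_
  rw [iteratedFDeriv_two_apply]
  have := (hd.hasFDerivAt.clm_apply
    (hasFDerivAt_const (EuclideanSpace.single i (1 : ℝ)) z)).fderiv
  change _ = fderiv ℝ (fun y => fderiv ℝ φ y (EuclideanSpace.single i 1)) z _
  rw [this]; simp

section radial
variable {k : ℝ → ℝ} {z : R2}

theorem contDiff_radial {n : WithTop ℕ∞} (hk : ContDiff ℝ n k) (z : R2) :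
    ContDiff ℝ n fun x : R2 => k (‖x - z‖ ^ 2) :=
  hk.comp ((contDiff_id.sub contDiff_const).norm_sq ℝ)

theorem pd_radial (hk : Differentiable ℝ k) (i : Fin 2) (x : R2) :
    pd i (fun x : R2 => k (‖x - z‖ ^ 2)) x = 2 * deriv k (‖x - z‖ ^ 2) * (x - z) i := by
  have h1 : HasFDerivAt (fun x : R2 => ‖x - z‖ ^ 2) _ x := ((hasFDerivAt_id x).sub_const z).norm_sq
  have h2 := ((hk (‖x - z‖ ^ 2)).hasDerivAt.comp_hasFDerivAt x h1).fderiv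
  change fderiv ℝ (k ∘ fun x : R2 => ‖x - z‖ ^ 2) x _ = _
  rw [h2]
  simp [EuclideanSpace.inner_single_right]
  ring

theorem norm_sq_eq_coord (x : R2) : ‖x‖ ^ 2 = x 0 ^ 2 + x 1 ^ 2 := by
  rw [EuclideanSpace.real_norm_sq_eq, Fin.sum_univ_two]

/-- In the variable s = r² the planar radial Laplacian is 4 (s k')', so it is determined by s k'(s).
-/
theorem laplacian_radial (hk : ContDiff ℝ ∞ k) (x : R2) :
    Laplacian.laplacian (fun x : R2 => k (‖x - z‖ ^ 2)) x =
      4 * (‖x - z‖ ^ 2 * deriv (deriv k) (‖x - z‖ ^ 2) + deriv k (‖x - z‖ ^ 2)) := by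
  have hk1 : Differentiable ℝ k := hk.differentiable (by simp)
  have hk' : ContDiff ℝ ∞ (deriv k) := ((contDiff_infty_iff_deriv).1 hk).2
  have hk2 : Differentiable ℝ (deriv k) := hk'.differentiable (by simp)
  rw [laplacian_eq_sum_pd (by exact mod_cast contDiff_infty.1 (contDiff_radial hk z) 2)]
  have h (i : Fin 2) : pd i (pd i fun x : R2 => k (‖x - z‖ ^ 2)) x =
      4 * deriv (deriv k) (‖x - z‖ ^ 2) * (x - z) i ^ 2 + 2 * deriv k (‖x - z‖ ^ 2) := by
    have e : pd i (fun x : R2 => k (‖x - z‖ ^ 2)) =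
        fun x => (2 * deriv k (‖x - z‖ ^ 2)) • (x - z) i := by
      ext x; rw [pd_radial hk1, smul_eq_mul]
    have hc : HasFDerivAt (fun x : R2 => (x - z) i) (EuclideanSpace.proj (𝕜 := ℝ) i) x := by
      have := (EuclideanSpace.proj (𝕜 := ℝ) i).hasFDerivAt.comp x
        ((hasFDerivAt_id (𝕜 := ℝ) x).sub_const z)
      exact this
    have e2 : (fun x : R2 => 2 * deriv k (‖x - z‖ ^ 2)) =
        fun x => (fun s => 2 * deriv k s) (‖x - z‖ ^ 2) := rfl
    rw [e, pd_smul (f := fun x : R2 => 2 * deriv k (‖x - z‖ ^ 2))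
      (((contDiff_radial hk' z).const_smul (2 : ℝ)).differentiable (by simp) x)
      hc.differentiableAt, e2, pd_radial (hk2.const_mul 2)]
    have : pd i (fun x : R2 => (x - z) i) x = 1 := by
      rw [pd, hc.fderiv]; simp
    rw [this, deriv_const_mul _ (hk2 _)]
    simp only [smul_eq_mul]
    ring
  rw [Fin.sum_univ_two, h, h, norm_sq_eq_coord (x - z)]
  ring

/-- The logarithmic potential estimate for the Jacobian of a smooth map. -/
theorem norm_integral_radial_jacobian_le (hk : ContDiff ℝ ∞ k)
    (hk' : ∀ s, |4 * Real.pi * (s * deriv k s)| ≤ 1) {v : R2 → R3} (hv : ContDiff ℝ 2 v)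
    (hc : HasCompactSupport v) (z : R2) :
    ‖∫ x, k (‖x - z‖ ^ 2) • ((2 : ℝ) • wedge (pd 0 v x) (pd 1 v x))‖ ≤
        (2 * Real.pi)⁻¹ * ∫ x, (‖pd 0 v x‖ ^ 2 + ‖pd 1 v x‖ ^ 2) ∧
    ‖∫ x, k (‖x - z‖ ^ 2) • ((2 : ℝ) • wedge (pd 0 v x) (pd 1 v x))‖ ≤
        (2 * Real.pi)⁻¹ * ∫ x, (√3 * (‖pd 0 v x‖ ^ 2 + ‖pd 1 v x‖ ^ 2) -
          2 * ‖wedge (pd 0 v x) (pd 1 v x)‖) := by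
  have hpi := Real.pi_pos
  have hk1 : Differentiable ℝ k := hk.differentiable (by simp)
  have hk2 : Continuous (deriv k) := (((contDiff_infty_iff_deriv).1 hk).2).continuous
  have hv1 : ContDiff ℝ 1 v := hv.of_le (by norm_num)
  have hp (i) : Continuous (pd i v) := (hv.pd (m := 0) i (by norm_num)).continuous
  have h0 := hp 0
  have h1 := hp 1
  have hW : Continuous fun x => wedge (pd 0 v x) (pd 1 v x) := continuous_wedge.comp (h0.prodMk h1)
  -- The gradient of a radial function points along x - z, so the rotated gradient differentiates v
  -- in the angular direction only.
  have e : ∀ x, wedge (v x) (pd 0 (fun x : R2 => k (‖x - z‖ ^ 2)) x • pd 1 v x -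
      pd 1 (fun x : R2 => k (‖x - z‖ ^ 2)) x • pd 0 v x) =
      (2 * deriv k (‖x - z‖ ^ 2)) • wedge (v x) (angular v z x) := fun x => by
    rw [pd_radial hk1, pd_radial hk1, ← wedge_smul_right, angular, smul_sub, smul_smul, smul_smul]
  have hmain := norm_integral_smul_wedge_angular_le (c := fun s => 2 * deriv k s)
    (by fun_prop) hv1 hc z
  rw [integral_smul_jacobian ((contDiff_radial hk z).of_le (by exact_mod_cast le_top)) hv hc,
    norm_neg]
  simp_rw [e]
  -- The factor r² in the bound for the angular derivative absorbs the singular weight: 2 r²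
  -- |k'(r²)| ≤ 1/(2π).
  have hbound : ∀ (F : ℝ) (x : R2), 0 ≤ F → ‖angular v z x‖ ^ 2 ≤ ‖x - z‖ ^ 2 * F →
      |2 * deriv k (‖x - z‖ ^ 2)| * ‖angular v z x‖ ^ 2 ≤ (2 * Real.pi)⁻¹ * F := by
    intro F x hF h
    calc |2 * deriv k (‖x - z‖ ^ 2)| * ‖angular v z x‖ ^ 2
        ≤ |2 * deriv k (‖x - z‖ ^ 2)| * (‖x - z‖ ^ 2 * F) := by gcongr
      _ = (2 * Real.pi)⁻¹ * (|4 * Real.pi * (‖x - z‖ ^ 2 * deriv k (‖x - z‖ ^ 2))| * F) := by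
        rw [abs_mul, abs_mul, abs_mul, abs_mul, abs_of_pos hpi, abs_of_nonneg (sq_nonneg ‖x - z‖),
          abs_of_pos (by norm_num : (0 : ℝ) < 2), abs_of_pos (by norm_num : (0 : ℝ) < 4)]
        field_simp
        ring
      _ ≤ (2 * Real.pi)⁻¹ * (1 * F) := by gcongr; exact hk' _
      _ = _ := by rw [one_mul]
  have hac : Continuous (angular v z) := by unfold angular; fun_prop
  have cs {G : R2 → ℝ} (hG : Continuous G) (h : ∀ x, pd 0 v x = 0 → pd 1 v x = 0 → G x = 0) :
      Integrable G := by
    refine hG.integrable_of_hasCompactSupport ((hc.fderiv ℝ).mono fun x hx => ?_)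
    contrapose! hx
    have : fderiv ℝ v x = 0 := by simpa using hx
    simpa using h x (by simp [pd, this]) (by simp [pd, this])
  have hi : Integrable fun x => |2 * deriv k (‖x - z‖ ^ 2)| * ‖angular v z x‖ ^ 2 :=
    cs (by fun_prop) fun x a b => by simp [angular, a, b]
  have pw1 (x : R2) := norm_rot_sq_le' ((x - z) 0) ((x - z) 1) (pd 0 v x) (pd 1 v x)
  have pw2 (x : R2) := norm_rot_sq_le ((x - z) 0) ((x - z) 1) (pd 0 v x) (pd 1 v x)
  simp only [← norm_sq_eq_coord] at pw1 pw2
  refine ⟨hmain.trans ?_, hmain.trans ?_⟩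
  · rw [← integral_const_mul]
    refine integral_mono hi ((cs (by fun_prop) fun x a b => by simp [a, b]).const_mul _) fun x => ?_
    exact hbound _ x (by positivity) (pw1 x)
  · rw [← integral_const_mul]
    refine integral_mono hi ((cs (by fun_prop) fun x a b => by
      simp [a, b, ← wedgeL_apply]).const_mul _) fun x => ?_
    refine hbound _ x ?_ (pw2 x)
    -- The density is nonnegative because 2|p ∧ q| ≤ |p|² + |q|² and √3 ≥ 1.
    have h3 : (1 : ℝ) ≤ √3 := by apply Real.le_sqrt_of_sq_le; norm_num
    nlinarith [norm_wedge_le (pd 0 v x) (pd 1 v x), sq_nonneg (‖pd 0 v x‖ - ‖pd 1 v x‖),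
      mul_nonneg (sub_nonneg.2 h3) (by positivity : 0 ≤ ‖pd 0 v x‖ ^ 2 + ‖pd 1 v x‖ ^ 2)]

end radial

/-! ### The truncated logarithm -/

/-- A smooth step from `0` on `(-∞, 1]` to `1` on `[2, ∞)`. -/
noncomputable def step (t : ℝ) : ℝ := Real.smoothTransition (t - 1)

theorem contDiff_step : ContDiff ℝ ∞ step :=
  Real.smoothTransition.contDiff.comp (contDiff_id.sub contDiff_const)

theorem step_of_le {t : ℝ} (h : t ≤ 1) : step t = 0 :=
  Real.smoothTransition.zero_of_nonpos (by linarith)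

theorem step_of_ge {t : ℝ} (h : 2 ≤ t) : step t = 1 :=
  Real.smoothTransition.one_of_one_le (by linarith)

theorem step_nonneg (t : ℝ) : 0 ≤ step t := Real.smoothTransition.nonneg _

theorem step_le_one (t : ℝ) : step t ≤ 1 := Real.smoothTransition.le_one _

theorem deriv_step_of_gt {t : ℝ} (h : 2 < t) : deriv step t = 0 := by
  have : step =ᶠ[nhds t] fun _ => 1 := by
    filter_upwards [lt_mem_nhds h] with s hs using step_of_ge hs.le
  rw [this.deriv_eq, deriv_const]

/-- The derivative of the truncated logarithm, as a function of the squared distance. -/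
noncomputable def logKernelDeriv (a b t : ℝ) : ℝ := (step (t / a) - step (t / b)) / (4 * Real.pi) / t

/-- The fundamental solution `log |x| / (2π)`, smoothed at the scale `a` and cut off at the
scale `b`, as a function of the squared distance. -/
noncomputable def logKernel (a b s : ℝ) : ℝ := ∫ t in (2 * b)..s, logKernelDeriv a b t

section kernel
variable {a b : ℝ}

theorem logKernelDeriv_of_lt (ha : 0 < a) (hab : a ≤ b) {t : ℝ} (ht : t < a) :
    logKernelDeriv a b t = 0 := by
  have hb : 0 < b := ha.trans_le hab
  rw [logKernelDeriv, step_of_le ((div_le_one ha).2 ht.le),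
    step_of_le ((div_le_one hb).2 (ht.le.trans hab))]
  simp

theorem logKernelDeriv_of_ge (ha : 0 < a) (hab : a ≤ b) {t : ℝ} (ht : 2 * b ≤ t) :
    logKernelDeriv a b t = 0 := by
  have hb : 0 < b := ha.trans_le hab
  rw [logKernelDeriv, step_of_ge ((le_div_iff₀ ha).2 (by linarith)),
    step_of_ge ((le_div_iff₀ hb).2 ht)]
  simp

/-- Division by t is harmless: the numerator vanishes identically for t < a. -/
theorem contDiff_logKernelDeriv (ha : 0 < a) (hab : a ≤ b) :
    ContDiff ℝ ∞ (logKernelDeriv a b) := by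
  rw [contDiff_iff_contDiffAt]
  intro t
  rcases lt_or_ge t a with h | h
  · refine (contDiffAt_const (c := (0 : ℝ))).congr_of_eventuallyEq ?_
    filter_upwards [gt_mem_nhds h] with s hs using logKernelDeriv_of_lt ha hab hs
  · have : ContDiffAt ℝ ∞ (fun t => (step (t / a) - step (t / b)) / (4 * Real.pi)) t := by
      have h1 : ContDiff ℝ ∞ fun t : ℝ => step (t / a) :=
        contDiff_step.comp (contDiff_id.div_const a)
      have h2 : ContDiff ℝ ∞ fun t : ℝ => step (t / b) :=
        contDiff_step.comp (contDiff_id.div_const b)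
      exact ((h1.sub h2).div_const _).contDiffAt
    exact this.div contDiffAt_id (ha.trans_le h).ne'

theorem deriv_logKernel (ha : 0 < a) (hab : a ≤ b) : deriv (logKernel a b) = logKernelDeriv a b := by
  ext s
  exact (contDiff_logKernelDeriv ha hab).continuous.deriv_integral _ _ _

theorem contDiff_logKernel (ha : 0 < a) (hab : a ≤ b) : ContDiff ℝ ∞ (logKernel a b) := by
  rw [contDiff_infty_iff_deriv, deriv_logKernel ha hab]
  refine ⟨fun s => ?_, contDiff_logKernelDeriv ha hab⟩
  have hc := (contDiff_logKernelDeriv ha hab).continuous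
  exact (intervalIntegral.integral_hasDerivAt_right (hc.intervalIntegrable _ _)
    hc.stronglyMeasurable.stronglyMeasurableAtFilter hc.continuousAt).differentiableAt

theorem logKernel_of_ge (ha : 0 < a) (hab : a ≤ b) {s : ℝ} (hs : 2 * b ≤ s) :
    logKernel a b s = 0 := by
  rw [logKernel, intervalIntegral.integral_congr (g := fun _ => 0), intervalIntegral.integral_zero]
  intro t ht
  rw [Set.uIcc_of_le hs] at ht
  exact logKernelDeriv_of_ge ha hab ht.1

/-- At t = 0 both sides vanish, so no condition on t is needed. This is the s k'(s) entering both
the size bound and the Laplacian. -/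
theorem mul_logKernelDeriv (t : ℝ) :
    t * logKernelDeriv a b t = (step (t / a) - step (t / b)) / (4 * Real.pi) := by
  rcases eq_or_ne t 0 with rfl | h
  · simp
  · rw [logKernelDeriv]; field_simp

theorem isTest_logKernel (ha : 0 < a) (hab : a ≤ b) (z : R2) :
    IsTest fun x : R2 => logKernel a b (‖x - z‖ ^ 2) := by
  refine ⟨contDiff_radial (contDiff_logKernel ha hab) z, ?_⟩
  refine HasCompactSupport.intro (isCompact_closedBall z √(2 * b)) fun x hx => ?_
  apply logKernel_of_ge ha hab
  rw [Metric.mem_closedBall, dist_eq_norm, not_le] at hx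
  exact (Real.lt_sq_of_sqrt_lt hx).le

theorem abs_mul_deriv_logKernel_le (ha : 0 < a) (hab : a ≤ b) (s : ℝ) :
    |4 * Real.pi * (s * deriv (logKernel a b) s)| ≤ 1 := by
  rw [deriv_logKernel ha hab, mul_logKernelDeriv, mul_div_cancel₀ (b := 4 * Real.pi) _
    (by positivity), abs_le]
  constructor <;> linarith [step_nonneg (s / a), step_le_one (s / a), step_nonneg (s / b),
    step_le_one (s / b)]

/-- A radial mollifier at the scale `√a` about `z`. -/
noncomputable def bump (a : ℝ) (z x : R2) : ℝ := deriv step (‖x - z‖ ^ 2 / a) / (Real.pi * a)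

/-- Differentiating s k'(s), a difference of two rescaled steps, gives one mollifier from the
smoothing near the pole and another, with a minus sign, from the outer cutoff. -/
theorem laplacian_logKernel (ha : 0 < a) (hab : a ≤ b) (z x : R2) :
    Laplacian.laplacian (fun x : R2 => logKernel a b (‖x - z‖ ^ 2)) x = bump a z x - bump b z x := by
  rw [laplacian_radial (contDiff_logKernel ha hab), deriv_logKernel ha hab]
  set s := ‖x - z‖ ^ 2
  have hq : HasDerivAt (logKernelDeriv a b) (deriv (logKernelDeriv a b) s) s :=
    ((contDiff_logKernelDeriv ha hab).differentiable (by simp) s).hasDerivAt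
  have h1 := (hasDerivAt_id s).mul hq
  have hs : ∀ t, HasDerivAt step (deriv step t) t := fun t =>
    (contDiff_step.differentiable (by simp) t).hasDerivAt
  have h2 : HasDerivAt (fun t => (step (t / a) - step (t / b)) / (4 * Real.pi))
      ((deriv step (s / a) * (1 / a) - deriv step (s / b) * (1 / b)) / (4 * Real.pi)) s :=
    (((hs (s / a)).comp s ((hasDerivAt_id s).div_const a)).sub
      ((hs (s / b)).comp s ((hasDerivAt_id s).div_const b))).div_const _
  have e : (id * logKernelDeriv a b) = fun t => (step (t / a) - step (t / b)) / (4 * Real.pi) := by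
    ext t; exact mul_logKernelDeriv t
  rw [e] at h1
  have := h1.unique h2
  simp only [id, one_mul] at this
  have hx : ‖x - z‖ ^ 2 = s := rfl
  rw [add_comm, this, bump, bump, hx]
  have hb : 0 < b := ha.trans_le hab
  field_simp

end kernel

/-! ### Radial mollifiers at small and large scales -/

open Filter Topology

theorem continuous_deriv_step : Continuous (deriv step) :=
  contDiff_step.continuous_deriv (by simp)

theorem monotone_step : Monotone step := fun _ _ h =>
  Real.smoothTransition.monotone (by linarith)

theorem deriv_step_nonneg (t : ℝ) : 0 ≤ deriv step t := monotone_step.deriv_nonneg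

theorem exists_deriv_step_le : ∃ C, ∀ t, 0 ≤ t → deriv step t ≤ C := by
  obtain ⟨C, hC⟩ := (isCompact_Icc (a := (0 : ℝ)) (b := 2)).exists_bound_of_continuousOn
    continuous_deriv_step.continuousOn
  refine ⟨C, fun t ht => ?_⟩
  rcases le_or_gt t 2 with h | h
  · exact (le_abs_self _).trans (hC t ⟨ht, h⟩)
  · rw [deriv_step_of_gt h]
    exact (norm_nonneg _).trans (hC 0 ⟨le_rfl, by norm_num⟩)

section bump
variable {a : ℝ}

theorem bump_nonneg (ha : 0 < a) (z x : R2) : 0 ≤ bump a z x :=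
  div_nonneg (deriv_step_nonneg _) (by positivity)

theorem continuous_bump (a : ℝ) (z : R2) : Continuous (bump a z) := by
  have := continuous_deriv_step
  unfold bump; fun_prop

theorem support_bump_subset (ha : 0 < a) (z : R2) :
    Function.support (bump a z) ⊆ Metric.closedBall z √(2 * a) := by
  intro x hx
  by_contra h
  rw [Metric.mem_closedBall, dist_eq_norm, not_le] at h
  have := Real.lt_sq_of_sqrt_lt h
  exact hx (by rw [bump, deriv_step_of_gt ((lt_div_iff₀ ha).2 this), zero_div])

theorem hasCompactSupport_bump (ha : 0 < a) (z : R2) : HasCompactSupport (bump a z) :=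
  HasCompactSupport.intro (isCompact_closedBall z √(2 * a)) fun x hx => by
    by_contra h
    exact hx (support_bump_subset ha z h)

/-- After integration over angles the radial density is the derivative of `step (r ^ 2 / a)`, which
climbs from 0 to 1. -/
theorem integral_bump (ha : 0 < a) (z : R2) : ∫ x, bump a z x = 1 := by
  have hpi := Real.pi_pos
  obtain ⟨h1, h2⟩ := integral_polar_iterated (continuous_bump a z) (hasCompactSupport_bump ha z) z
  have e : ∀ r : ℝ, ∫ θ in (-Real.pi)..Real.pi, r • bump a z (z + r • circ θ) =
      deriv step (r ^ 2 / a) * (2 * r / a) := fun r => by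
    have : ∀ θ, r • bump a z (z + r • circ θ) = r * (deriv step (r ^ 2 / a) / (Real.pi * a)) :=
      fun θ => by
        rw [bump, add_sub_cancel_left, norm_smul, norm_circ, mul_one, Real.norm_eq_abs, sq_abs,
          smul_eq_mul]
    simp_rw [this]
    rw [intervalIntegral.integral_const, smul_eq_mul]
    field_simp
    ring
  simp_rw [e] at h1 h2
  rw [h2]
  have hd (r : ℝ) : HasDerivAt (fun r => step (r ^ 2 / a)) (deriv step (r ^ 2 / a) * (2 * r / a)) r := by
    have := (contDiff_step.differentiable (by simp) (r ^ 2 / a)).hasDerivAt.comp r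
      ((hasDerivAt_pow 2 r).div_const a)
    simpa [Function.comp_def] using this
  have ht : Tendsto (fun r : ℝ => step (r ^ 2 / a)) atTop (𝓝 1) := by
    refine tendsto_const_nhds.congr' ?_
    filter_upwards [eventually_ge_atTop (max 1 (2 * a))] with r hr
    have h1 : 1 ≤ r := (le_max_left _ _).trans hr
    have h2 : 2 * a ≤ r := (le_max_right _ _).trans hr
    exact (step_of_ge ((le_div_iff₀ ha).2 (by nlinarith))).symm
  rw [integral_Ioi_of_hasDerivAt_of_tendsto (hd 0).continuousAt.continuousWithinAt
    (fun r _ => hd r) h1 ht]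
  simp [step_of_le]

theorem bump_le {C : ℝ} (hC : ∀ t, 0 ≤ t → deriv step t ≤ C) (ha : 0 < a) (z x : R2) :
    bump a z x ≤ C / (Real.pi * a) := by
  have hpi := Real.pi_pos
  exact div_le_div_of_nonneg_right (hC _ (by positivity)) (by positivity)

/-- At almost every point the radial mollifiers recover the function. -/
theorem ae_tendsto_integral_bump {u : R2 → R3} (hu : LocallyIntegrable u) :
    ∀ᵐ z, Tendsto (fun a => ∫ x, bump a z x • u x) (𝓝[>] 0) (𝓝 (u z)) := by
  obtain ⟨C, hC⟩ := exists_deriv_step_le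
  filter_upwards [IsUnifLocDoublingMeasure.ae_tendsto_average_norm_sub volume hu 1] with z hz
  have hs : Tendsto (fun a : ℝ => √(2 * a)) (𝓝[>] 0) (𝓝[>] 0) := by
    refine tendsto_nhdsWithin_iff.2 ⟨?_, ?_⟩
    · have : ContinuousAt (fun a : ℝ => √(2 * a)) 0 := by fun_prop
      have h := this.tendsto
      simp only [mul_zero, Real.sqrt_zero] at h
      exact h.mono_left nhdsWithin_le_nhds
    · filter_upwards [self_mem_nhdsWithin] with a ha
      exact Real.sqrt_pos.2 (by have : (0 : ℝ) < a := ha; positivity)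
  have hpos : ∀ᶠ a : ℝ in 𝓝[>] 0, 0 < a := self_mem_nhdsWithin
  -- The supporting ball has area 2πa, so the height bound C/(πa) is 2C divided by that area.
  refine tendsto_integral_smul_of_tendsto_average_norm_sub (2 * C)
    (hz (fun _ => z) (fun a : ℝ => √(2 * a)) hs ?_) ?_ ?_ ?_ ?_
  · exact Eventually.of_forall fun a => Metric.mem_closedBall_self (by positivity)
  · exact Eventually.of_forall fun a => hu.integrableOn_isCompact (isCompact_closedBall _ _)
  · refine tendsto_const_nhds.congr' ?_
    filter_upwards [hpos] with a ha using (integral_bump ha z).symm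
  · filter_upwards [hpos] with a ha using support_bump_subset ha z
  · filter_upwards [hpos] with a ha x
    have hpi := Real.pi_pos
    rw [abs_of_nonneg (bump_nonneg ha z x), Measure.real,
      EuclideanSpace.volume_closedBall_fin_two]
    refine (bump_le hC ha z x).trans_eq ?_
    rw [← ENNReal.ofReal_pow (Real.sqrt_nonneg _), Real.sq_sqrt (by positivity),
      ← NNReal.coe_real_pi]
    simp [ha.le]
    field_simp
    rw [ENNReal.toReal_ofReal hpi.le]

/-- The mollifier has mass one and height O(1/b), so its L² norm is O(b^(-1/2)). This is where
square integrability of u excludes an additive constant. -/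
theorem tendsto_integral_bump_atTop {u : R2 → R3} (hu : MemLp u 2) (z : R2) :
    Tendsto (fun b => ∫ x, bump b z x • u x) atTop (𝓝 0) := by
  obtain ⟨C, hC⟩ := exists_deriv_step_le
  have hpi := Real.pi_pos
  set U := ∫ x, ‖u x‖ ^ 2
  have hU : Integrable fun x => ‖u x‖ ^ 2 := hu.integrable_norm_pow (by norm_num)
  refine squeeze_zero_norm' (a := fun b => 1 / 2 * ((√b)⁻¹ * (C / Real.pi + U))) ?_ ?_
  · filter_upwards [eventually_gt_atTop 0] with b hb
    have hsb : 0 < √b := Real.sqrt_pos.2 hb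
    have hB : Integrable (bump b z) :=
      (continuous_bump b z).integrable_of_hasCompactSupport (hasCompactSupport_bump hb z)
    have hbd : Integrable fun x => 1 / 2 * (√b * (C / (Real.pi * b) * bump b z x) +
        (√b)⁻¹ * ‖u x‖ ^ 2) :=
      (((hB.const_mul _).const_mul _).add (hU.const_mul _)).const_mul _
    refine (norm_integral_le_of_norm_le hbd (Eventually.of_forall fun x => ?_)).trans_eq ?_
    · rw [norm_smul, Real.norm_of_nonneg (bump_nonneg hb z x)]
      have h1 : bump b z x ^ 2 ≤ C / (Real.pi * b) * bump b z x := by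
        rw [sq]; exact mul_le_mul_of_nonneg_right (bump_le hC hb z x) (bump_nonneg hb z x)
      -- Young's inequality with weight √b makes both resulting terms of order 1/√b after
      -- integration.
      have h2 : bump b z x * ‖u x‖ ≤ 1 / 2 * (√b * bump b z x ^ 2 + (√b)⁻¹ * ‖u x‖ ^ 2) := by
        have : 0 ≤ (√b)⁻¹ * (√b * bump b z x - ‖u x‖) ^ 2 := by positivity
        have e : (√b)⁻¹ * (√b * bump b z x - ‖u x‖) ^ 2 =
          √b * bump b z x ^ 2 - 2 * (bump b z x * ‖u x‖) + (√b)⁻¹ * ‖u x‖ ^ 2 := by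
          field_simp
          ring
        linarith
      exact h2.trans (by gcongr)
    · rw [integral_const_mul, integral_add ((hB.const_mul _).const_mul _) (hU.const_mul _),
        integral_const_mul, integral_const_mul, integral_const_mul, integral_bump hb]
      have : √b * (C / (Real.pi * b) * 1) = (√b)⁻¹ * (C / Real.pi) := by
        nth_rw 2 [← Real.mul_self_sqrt hb.le]
        field_simp
      rw [this]; ring
  · have : Tendsto (fun b : ℝ => (√b)⁻¹) atTop (𝓝 0) :=
      tendsto_inv_atTop_zero.comp Real.tendsto_sqrt_atTop
    have h := (this.mul_const (C / Real.pi + U)).const_mul (1 / 2)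
    rwa [zero_mul, mul_zero] at h

/-- A square integrable function is bounded as soon as its distributional Laplacian is bounded when
tested with the truncated logarithms. -/
theorem ae_norm_le_of_laplacian {u : R2 → R3} (hu : MemLp u 2) {M : ℝ}
    (h : ∀ (z : R2) (a b : ℝ), 0 < a → a ≤ b →
      ‖∫ x, Laplacian.laplacian (fun x : R2 => logKernel a b (‖x - z‖ ^ 2)) x • u x‖ ≤ M) :
    ∀ᵐ z, ‖u z‖ ≤ M := by
  have hloc : LocallyIntegrable u := hu.locallyIntegrable (by norm_num)
  filter_upwards [ae_tendsto_integral_bump hloc] with z hz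
  have hI {b : ℝ} (hb : 0 < b) : Integrable fun x => bump b z x • u x :=
    hloc.integrable_smul_left_of_hasCompactSupport (continuous_bump b z)
      (hasCompactSupport_bump hb z)
  refine le_of_tendsto hz.norm ?_
  filter_upwards [self_mem_nhdsWithin] with a ha
  have ha : 0 < a := ha
  have ht := (tendsto_integral_bump_atTop hu z).const_sub (∫ x, bump a z x • u x)
  rw [sub_zero] at ht
  refine le_of_tendsto ht.norm ?_
  filter_upwards [eventually_ge_atTop a] with b hab
  have := h z a b ha hab
  simp_rw [laplacian_logKernel ha hab, sub_smul] at this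
  rwa [integral_sub (hI ha) (hI (ha.trans_le hab))] at this

end bump

/-! ### Mollification and density of test maps -/

open scoped Convolution

/-- The convolution of a scalar kernel with a vector valued function. -/
local notation:67 ρ " ⋆ᵥ " g:66 => convolution ρ g (ContinuousLinearMap.lsmul ℝ ℝ) volume

section mollify
variable {ρ : R2 → ℝ}

theorem convolution_lsmul_apply (ρ : R2 → ℝ) (g : R2 → R3) (x : R2) :
    (ρ ⋆ᵥ g) x = ∫ t, ρ t • g (x - t) := rfl

/-- Jensen's inequality for mollification. -/
theorem norm_convolution_sq_le (hρ : ContDiff ℝ ∞ ρ) (hc : HasCompactSupport ρ)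
    (h0 : ∀ x, 0 ≤ ρ x) (h1 : ∫ x, ρ x = 1) {g : R2 → R3} (hg : MemLp g 2) (x : R2) :
    ‖(ρ ⋆ᵥ g) x‖ ^ 2 ≤ ∫ t, ρ t * ‖g (x - t)‖ ^ 2 := by
  have hloc : LocallyIntegrable g := hg.locallyIntegrable (by norm_num)
  have hsq : Integrable fun x => ‖g x‖ ^ 2 := hg.integrable_norm_pow (by norm_num)
  have i1 : Integrable fun t => ρ t • g (x - t) :=
    hc.convolutionExists_left (ContinuousLinearMap.lsmul ℝ ℝ) hρ.continuous hloc x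
  have i2 : Integrable fun t => ρ t * ‖g (x - t)‖ ^ 2 :=
    hc.convolutionExists_left (ContinuousLinearMap.lsmul ℝ ℝ) hρ.continuous
      hsq.locallyIntegrable x
  have i0 : Integrable ρ := hρ.continuous.integrable_of_hasCompactSupport hc
  set c := (ρ ⋆ᵥ g) x with hcdef
  have hc' : ∫ t, ρ t • g (x - t) = c := rfl
  have i3 : Integrable fun t => 2 * inner ℝ c (ρ t • g (x - t)) := (i1.const_inner c).const_mul 2
  -- The variance about the weighted mean c is nonnegative; expanding the square gives Jensen.
  have hnn : 0 ≤ ∫ t, ρ t * ‖g (x - t) - c‖ ^ 2 :=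
    integral_nonneg fun t => mul_nonneg (h0 t) (by positivity)
  have e : ∀ t, ρ t * ‖g (x - t) - c‖ ^ 2 =
      ρ t * ‖g (x - t)‖ ^ 2 - 2 * inner ℝ c (ρ t • g (x - t)) + ρ t * ‖c‖ ^ 2 := fun t => by
    rw [norm_sub_sq_real, inner_smul_right, real_inner_comm]
    ring
  simp_rw [e] at hnn
  have i23 : Integrable fun t => ρ t * ‖g (x - t)‖ ^ 2 - 2 * inner ℝ c (ρ t • g (x - t)) := i2.sub i3
  rw [integral_add i23 (i0.mul_const _), integral_sub i2 i3, integral_const_mul,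
    integral_inner i1, hc', integral_mul_const, h1, real_inner_self_eq_norm_sq] at hnn
  linarith

theorem integral_norm_convolution_sq_le (hρ : ContDiff ℝ ∞ ρ) (hc : HasCompactSupport ρ)
    (h0 : ∀ x, 0 ≤ ρ x) (h1 : ∫ x, ρ x = 1) {g : R2 → R3} (hg : MemLp g 2) :
    MemLp (ρ ⋆ᵥ g) 2 ∧ ∫ x, ‖(ρ ⋆ᵥ g) x‖ ^ 2 ≤ ∫ x, ‖g x‖ ^ 2 := by
  have hloc : LocallyIntegrable g := hg.locallyIntegrable (by norm_num)
  have hsq : Integrable fun x => ‖g x‖ ^ 2 := hg.integrable_norm_pow (by norm_num)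
  have i0 : Integrable ρ := hρ.continuous.integrable_of_hasCompactSupport hc
  have hcont : Continuous (ρ ⋆ᵥ g) :=
    (hc.contDiff_convolution_left (ContinuousLinearMap.lsmul ℝ ℝ) hρ hloc).continuous
  have i3 : Integrable fun x => ∫ t, ρ t * ‖g (x - t)‖ ^ 2 :=
    i0.integrable_convolution (ContinuousLinearMap.lsmul ℝ ℝ) hsq
  have e3 : ∫ x, ∫ t, ρ t * ‖g (x - t)‖ ^ 2 = ∫ x, ‖g x‖ ^ 2 := by
    have := integral_convolution (ContinuousLinearMap.lsmul ℝ ℝ) (μ := volume) (ν := volume) i0 hsq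
    simp only [h1, ContinuousLinearMap.lsmul_apply, one_smul] at this
    exact this
  have hle := norm_convolution_sq_le hρ hc h0 h1 hg
  have i4 : Integrable fun x => ‖(ρ ⋆ᵥ g) x‖ ^ 2 := by
    refine i3.mono' (by fun_prop) (Eventually.of_forall fun x => ?_)
    rw [Real.norm_of_nonneg (by positivity)]
    exact hle x
  refine ⟨(memLp_two_iff_integrable_sq_norm hcont.aestronglyMeasurable).2 i4, ?_⟩
  rw [← e3]
  exact integral_mono i4 i3 hle

theorem norm_convolution_le (hρ : ContDiff ℝ ∞ ρ) (hc : HasCompactSupport ρ)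
    (h0 : ∀ x, 0 ≤ ρ x) (h1 : ∫ x, ρ x = 1) {g : R2 → R3} {M : ℝ} (hM : ∀ᵐ x, ‖g x‖ ≤ M) (x : R2) :
    ‖(ρ ⋆ᵥ g) x‖ ≤ M := by
  have i0 : Integrable ρ := hρ.continuous.integrable_of_hasCompactSupport hc
  have h := (volume.measurePreserving_sub_left x).quasiMeasurePreserving.ae hM
  rw [convolution_lsmul_apply]
  refine (norm_integral_le_of_norm_le (i0.mul_const M) ?_).trans_eq ?_
  · filter_upwards [h] with t ht
    rw [norm_smul, Real.norm_of_nonneg (h0 t)]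
    exact mul_le_mul_of_nonneg_left ht (h0 t)
  · rw [integral_mul_const, h1, one_mul]

/-- The derivative of a mollification falls on the kernel. -/
theorem pd_convolution_eq_integral (hρ : ContDiff ℝ ∞ ρ) (hc : HasCompactSupport ρ) {w : R2 → R3}
    (hw : LocallyIntegrable w) (i : Fin 2) (x : R2) :
    pd i (ρ ⋆ᵥ w) x = ∫ t, pd i ρ t • w (x - t) := by
  have hρ1 : ContDiff ℝ 1 ρ := hρ.of_le (by exact_mod_cast le_top)
  let L : ℝ →L[ℝ] R3 →L[ℝ] R3 := ContinuousLinearMap.lsmul ℝ ℝ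
  have hex := ((hc.fderiv ℝ).convolutionExists_left (L.precompL R2)
      (hρ1.continuous_fderiv (by norm_num)) hw x).integrable
  have hd := (hc.hasFDerivAt_convolution_left L hρ1 hw x).fderiv
  rw [convolution_def] at hd
  rw [pd, hd, ContinuousLinearMap.integral_apply hex]
  refine integral_congr_ae (Eventually.of_forall fun t => ?_)
  simp only [ContinuousLinearMap.precompL_apply]
  rfl

/-- Mollification commutes with weak derivatives. -/
theorem pd_convolution (hρ : ContDiff ℝ ∞ ρ) (hc : HasCompactSupport ρ) {w g : R2 → R3}
    {i : Fin 2} (hw : HasWeakPartial i w g) (x : R2) : pd i (ρ ⋆ᵥ w) x = (ρ ⋆ᵥ g) x := by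
  have hφ : IsTest fun t => ρ (x - t) := by
    refine ⟨hρ.comp (contDiff_const.sub contDiff_id), ?_⟩
    exact hc.comp_homeomorph (Homeomorph.subLeft x)
  have hpφ (t) : partialDeriv i (fun t => ρ (x - t)) t = -pd i ρ (x - t) := by
    have h1 := ((hρ.differentiable (by simp) (x - t)).hasFDerivAt.comp t
      ((hasFDerivAt_id (𝕜 := ℝ) t).const_sub x)).fderiv
    change fderiv ℝ (fun t => ρ (x - t)) t = _ at h1
    rw [partialDeriv, h1]
    simp [pd]
  have hw2 := hw.2.2 _ hφ
  simp only [hpφ, neg_smul, integral_neg, neg_inj] at hw2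
  have e (h : R2 → ℝ) (f : R2 → R3) : ∫ t, h t • f (x - t) = ∫ t, h (x - t) • f t := by
    rw [← integral_sub_left_eq_self (fun t => h t • f (x - t)) volume x]
    simp only [sub_sub_cancel]
  rw [pd_convolution_eq_integral hρ hc hw.1, e, hw2, convolution_lsmul_apply, e]

end mollify

/-- Almost everywhere convergence without gain of norm is strong convergence in `L²`. -/
theorem tendsto_integral_norm_sub_sq {f : ℕ → R2 → R3} {g : R2 → R3} (hf : ∀ n, MemLp (f n) 2)
    (hg : MemLp g 2) (hle : ∀ n, ∫ x, ‖f n x‖ ^ 2 ≤ ∫ x, ‖g x‖ ^ 2)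
    (hlim : ∀ᵐ x, Tendsto (fun n => f n x) atTop (𝓝 (g x))) :
    Tendsto (fun n => ∫ x, ‖f n x - g x‖ ^ 2) atTop (𝓝 0) := by
  have sqi {h : R2 → R3} (hh : MemLp h 2) : Integrable fun x => ‖h x‖ ^ 2 :=
    hh.integrable_norm_pow (by norm_num)
  have iG := sqi hg
  have iF n := sqi (hf n)
  have iD n : Integrable fun x => ‖f n x - g x‖ ^ 2 := sqi ((hf n).sub hg)
  set G := ∫ x, ‖g x‖ ^ 2
  -- Fatou is applied to this nonnegative quantity, whose pointwise limit is 4|g|². The norm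
  -- hypothesis bounds its integral by 4G - ∫ |f_n - g|², forcing the last term to zero.
  have hnn : ∀ n x, 0 ≤ 2 * ‖f n x‖ ^ 2 + 2 * ‖g x‖ ^ 2 - ‖f n x - g x‖ ^ 2 := fun n x => by
    nlinarith [parallelogram_law_with_norm ℝ (f n x) (g x), sq_nonneg ‖f n x + g x‖]
  have iH n : Integrable fun x => 2 * ‖f n x‖ ^ 2 + 2 * ‖g x‖ ^ 2 - ‖f n x - g x‖ ^ 2 :=
    (((iF n).const_mul 2).add (iG.const_mul 2)).sub (iD n)
  have eH n : ∫ x, (2 * ‖f n x‖ ^ 2 + 2 * ‖g x‖ ^ 2 - ‖f n x - g x‖ ^ 2) ≤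
      4 * G - ∫ x, ‖f n x - g x‖ ^ 2 := by
    have i2 : Integrable fun x => 2 * ‖f n x‖ ^ 2 + 2 * ‖g x‖ ^ 2 :=
      ((iF n).const_mul 2).add (iG.const_mul 2)
    rw [integral_sub i2 (iD n),
      integral_add ((iF n).const_mul 2) (iG.const_mul 2), integral_const_mul, integral_const_mul]
    linarith [hle n]
  have hFatou : ENNReal.ofReal (4 * G) ≤
      liminf (fun n => ENNReal.ofReal (4 * G - ∫ x, ‖f n x - g x‖ ^ 2)) atTop := by
    calc ENNReal.ofReal (4 * G) = ∫⁻ x, ENNReal.ofReal (4 * ‖g x‖ ^ 2) := by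
          rw [← ofReal_integral_eq_lintegral_ofReal (iG.const_mul 4)
            (Eventually.of_forall fun x => by positivity), integral_const_mul]
      _ ≤ ∫⁻ x, liminf (fun n => ENNReal.ofReal
            (2 * ‖f n x‖ ^ 2 + 2 * ‖g x‖ ^ 2 - ‖f n x - g x‖ ^ 2)) atTop := by
          refine lintegral_mono_ae ?_
          filter_upwards [hlim] with x hx
          have : Tendsto (fun n => ENNReal.ofReal
              (2 * ‖f n x‖ ^ 2 + 2 * ‖g x‖ ^ 2 - ‖f n x - g x‖ ^ 2)) atTop
              (𝓝 (ENNReal.ofReal (2 * ‖g x‖ ^ 2 + 2 * ‖g x‖ ^ 2 - ‖g x - g x‖ ^ 2))) := by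
            refine ENNReal.tendsto_ofReal ?_
            exact (((hx.norm.pow 2).const_mul 2).add_const _).sub ((hx.sub_const _).norm.pow 2)
          rw [this.liminf_eq]
          refine ENNReal.ofReal_le_ofReal ?_
          simp only [sub_self, norm_zero]
          linarith
      _ ≤ liminf (fun n => ∫⁻ x, ENNReal.ofReal
            (2 * ‖f n x‖ ^ 2 + 2 * ‖g x‖ ^ 2 - ‖f n x - g x‖ ^ 2)) atTop :=
          lintegral_liminf_le' fun n => (iH n).aemeasurable.ennreal_ofReal
      _ ≤ _ := by
          refine liminf_le_liminf (Eventually.of_forall fun n => ?_)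
          rw [← ofReal_integral_eq_lintegral_ofReal (iH n) (Eventually.of_forall (hnn n))]
          exact ENNReal.ofReal_le_ofReal (eH n)
  rw [Metric.tendsto_atTop']
  intro ε hε
  have hD0 n : 0 ≤ ∫ x, ‖f n x - g x‖ ^ 2 := integral_nonneg fun x => by positivity
  have hD4 n : ∫ x, ‖f n x - g x‖ ^ 2 ≤ 4 * G := by
    have : 0 ≤ ∫ x, (2 * ‖f n x‖ ^ 2 + 2 * ‖g x‖ ^ 2 - ‖f n x - g x‖ ^ 2) :=
      integral_nonneg (hnn n)
    linarith [eH n]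
  suffices ∀ᶠ n in atTop, ∫ x, ‖f n x - g x‖ ^ 2 < ε by
    obtain ⟨N, hN⟩ := eventually_atTop.1 this
    refine ⟨N, fun n hn => ?_⟩
    rw [Real.dist_0_eq_abs, abs_of_nonneg (hD0 n)]
    exact hN n hn.le
  -- `ENNReal.ofReal` truncates negative numbers to 0, so the comparison below needs 4G - ε ≥ 0;
  -- otherwise the crude bound 4G suffices.
  rcases lt_or_ge (4 * G) ε with h | h
  · exact Eventually.of_forall fun n => (hD4 n).trans_lt h
  · have hlt : ENNReal.ofReal (4 * G - ε) < ENNReal.ofReal (4 * G) :=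
      (ENNReal.ofReal_lt_ofReal_iff (by linarith)).2 (by linarith)
    filter_upwards [eventually_lt_of_lt_liminf (hlt.trans_le hFatou)] with n hn
    have := (ENNReal.ofReal_lt_ofReal_iff_of_nonneg (by linarith)).1 hn
    linarith

/-- Test maps are dense in `H¹`, with control of the supremum. -/
theorem exists_smooth_approx {w : R2 → R3} (hw : MemLp w 2) {g : Fin 2 → R2 → R3}
    (hg : ∀ i, HasWeakPartial i w (g i)) (hg2 : ∀ i, MemLp (g i) 2) :
    ∃ W : ℕ → R2 → R3, (∀ n, ContDiff ℝ ∞ (W n)) ∧ (∀ n, HasCompactSupport (W n)) ∧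
      (∀ i, Tendsto (fun n => ∫ x, ‖pd i (W n) x - g i x‖ ^ 2) atTop (𝓝 0)) ∧
      ∀ M, (∀ᵐ x, ‖w x‖ ≤ M) → ∀ n x, ‖W n x‖ ≤ M := by
  let b : ℕ → ContDiffBump (0 : R2) := fun n =>
    ⟨1 / (n + 1), 2 / (n + 1), by positivity, by gcongr; norm_num⟩
  let ρ : ℕ → R2 → ℝ := fun n => (b n).normed volume
  have hρ n : ContDiff ℝ ∞ (ρ n) := (b n).contDiff_normed
  have hρc n : HasCompactSupport (ρ n) := (b n).hasCompactSupport_normed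
  have hρ0 n x : 0 ≤ ρ n x := (b n).nonneg_normed x
  have hρ1 n : ∫ x, ρ n x = 1 := (b n).integral_normed
  let ζ : ContDiffBump (0 : R2) := ⟨1, 2, by norm_num, by norm_num⟩
  have hζs : ContDiff ℝ ∞ ζ := ζ.contDiff
  let Z : ℕ → R2 → ℝ := fun n x => ζ (((n : ℝ) + 1)⁻¹ • x)
  have hZ n : ContDiff ℝ ∞ (Z n) := hζs.comp (contDiff_const_smul _)
  have hZ1 n x : |Z n x| ≤ 1 := by
    rw [abs_of_nonneg ζ.nonneg]; exact ζ.le_one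
  have hZc n : HasCompactSupport (Z n) :=
    ζ.hasCompactSupport.comp_homeomorph (Homeomorph.smulOfNeZero (((n : ℝ) + 1)⁻¹) (by positivity))
  obtain ⟨C, hC⟩ : ∃ C, ∀ i x, ‖pd i ζ x‖ ≤ C := by
    have h (i) : ∃ C, ∀ x, ‖pd i ζ x‖ ≤ C :=
      (ζ.hasCompactSupport.pd i).exists_bound_of_continuous
        (hζs.pd (m := 0) i (by simp)).continuous
    choose C hC using h
    exact ⟨max (C 0) (C 1), fun i x => by
      fin_cases i
      · exact (hC 0 x).trans (le_max_left _ _)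
      · exact (hC 1 x).trans (le_max_right _ _)⟩
  have hpZ n i x : pd i (Z n) x = ((n : ℝ) + 1)⁻¹ * pd i ζ (((n : ℝ) + 1)⁻¹ • x) := by
    have h1 := (hζs.differentiable (by simp) (((n : ℝ) + 1)⁻¹ • x)).hasFDerivAt.comp x
      ((hasFDerivAt_id (𝕜 := ℝ) x).const_smul (((n : ℝ) + 1)⁻¹))
    change fderiv ℝ (ζ ∘ fun x => ((n : ℝ) + 1)⁻¹ • id x) x _ = _
    have h2 := h1.fderiv
    erw [h2]
    simp [pd]
  have hloc : LocallyIntegrable w := hw.locallyIntegrable (by norm_num)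
  have hwn n : ContDiff ℝ ∞ (ρ n ⋆ᵥ w) :=
    (hρc n).contDiff_convolution_left (ContinuousLinearMap.lsmul ℝ ℝ) (hρ n) hloc
  have hgc n i : Continuous (ρ n ⋆ᵥ g i) :=
    ((hρc n).contDiff_convolution_left (ContinuousLinearMap.lsmul ℝ ℝ) (hρ n) (hg i).2.1).continuous
  have sqi {h : R2 → R3} (hh : MemLp h 2) : Integrable fun x => ‖h x‖ ^ 2 :=
    hh.integrable_norm_pow (by norm_num)
  refine ⟨fun n x => Z n x • (ρ n ⋆ᵥ w) x, fun n => (hZ n).smul (hwn n),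
    fun n => (hZc n).smul_right, fun i => ?_, fun M hM n x => ?_⟩
  -- The approximation is a cutoff times a mollification. The term in which the cutoff is
  -- differentiated is O(1/n) in L², since the cutoff lives at scale n + 1.
  · have hpd n x : pd i (fun x => Z n x • (ρ n ⋆ᵥ w) x) x =
        Z n x • (ρ n ⋆ᵥ g i) x + pd i (Z n) x • (ρ n ⋆ᵥ w) x := by
      rw [pd_smul ((hZ n).differentiable (by simp) x) ((hwn n).differentiable (by simp) x),
        pd_convolution (hρ n) (hρc n) (hg i)]
    have hml n : MemLp (fun x => Z n x • (ρ n ⋆ᵥ g i) x) 2 := by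
      refine (integral_norm_convolution_sq_le (hρ n) (hρc n) (hρ0 n) (hρ1 n) (hg2 i)).1.mono
        ((hZ n).continuous.smul (hgc n i)).aestronglyMeasurable (Eventually.of_forall fun x => ?_)
      rw [norm_smul]
      exact mul_le_of_le_one_left (norm_nonneg _) (hZ1 n x)
    have ht1 : Tendsto (fun n => ∫ x, ‖Z n x • (ρ n ⋆ᵥ g i) x - g i x‖ ^ 2) atTop (𝓝 0) := by
      refine tendsto_integral_norm_sub_sq hml (hg2 i) (fun n => ?_) ?_
      · have := integral_norm_convolution_sq_le (hρ n) (hρc n) (hρ0 n) (hρ1 n) (hg2 i)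
        refine (integral_mono (sqi (hml n)) (sqi this.1) fun x => ?_).trans this.2
        have : ‖Z n x • (ρ n ⋆ᵥ g i) x‖ ≤ ‖(ρ n ⋆ᵥ g i) x‖ := by
          rw [norm_smul]
          exact mul_le_of_le_one_left (norm_nonneg _) (hZ1 n x)
        exact pow_le_pow_left₀ (norm_nonneg _) this 2
      · have hr : Tendsto (fun n => (b n).rOut) atTop (𝓝 0) := by
          have := (tendsto_one_div_add_atTop_nhds_zero_nat (𝕜 := ℝ)).const_mul 2
          rw [mul_zero] at this
          refine this.congr fun n => ?_
          change 2 * (1 / ((n : ℝ) + 1)) = 2 / ((n : ℝ) + 1)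
          ring
        have hK : ∀ᶠ n in atTop, (b n).rOut ≤ 2 * (b n).rIn := Eventually.of_forall fun n => by
          change 2 / ((n : ℝ) + 1) ≤ 2 * (1 / ((n : ℝ) + 1))
          rw [mul_one_div]
        filter_upwards [ContDiffBump.ae_convolution_tendsto_right_of_locallyIntegrable hr hK
          (hg i).2.1] with x hx
        have hz : Tendsto (fun n => Z n x) atTop (𝓝 1) := by
          have h0 : Tendsto (fun n : ℕ => ((n : ℝ) + 1)⁻¹ • x) atTop (𝓝 0) := by
            have := (tendsto_one_div_add_atTop_nhds_zero_nat (𝕜 := ℝ)).smul_const x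
            simpa using this
          have h1 := (hζs.continuous.tendsto 0).comp h0
          rwa [ζ.one_of_mem_closedBall (Metric.mem_closedBall_self (by norm_num))] at h1
        simpa using hz.smul hx
    have hww n := integral_norm_convolution_sq_le (hρ n) (hρc n) (hρ0 n) (hρ1 n) hw
    have hP n x : ‖pd i (Z n) x • (ρ n ⋆ᵥ w) x‖ ≤ ((n : ℝ) + 1)⁻¹ * C * ‖(ρ n ⋆ᵥ w) x‖ := by
      rw [norm_smul, hpZ, norm_mul, Real.norm_of_nonneg (by positivity : 0 ≤ ((n : ℝ) + 1)⁻¹)]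
      gcongr
      exact hC i _
    have hbound n : ∫ x, ‖pd i (fun x => Z n x • (ρ n ⋆ᵥ w) x) x - g i x‖ ^ 2 ≤
        2 * (∫ x, ‖Z n x • (ρ n ⋆ᵥ g i) x - g i x‖ ^ 2) +
          2 * (((n : ℝ) + 1)⁻¹ * C) ^ 2 * ∫ x, ‖w x‖ ^ 2 := by
      have j1 : Integrable fun x => ‖Z n x • (ρ n ⋆ᵥ g i) x - g i x‖ ^ 2 :=
        sqi ((hml n).sub (hg2 i))
      have j2 := sqi (hww n).1
      calc _ ≤ ∫ x, (2 * ‖Z n x • (ρ n ⋆ᵥ g i) x - g i x‖ ^ 2 +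
            2 * (((n : ℝ) + 1)⁻¹ * C) ^ 2 * ‖(ρ n ⋆ᵥ w) x‖ ^ 2) := by
            refine integral_mono_of_nonneg (Eventually.of_forall fun x => by positivity)
              ((j1.const_mul 2).add (j2.const_mul _)) (Eventually.of_forall fun x => ?_)
            dsimp only
            rw [hpd, add_sub_right_comm]
            set A := Z n x • (ρ n ⋆ᵥ g i) x - g i x
            set B := pd i (Z n) x • (ρ n ⋆ᵥ w) x
            have hB : ‖B‖ ^ 2 ≤ (((n : ℝ) + 1)⁻¹ * C * ‖(ρ n ⋆ᵥ w) x‖) ^ 2 :=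
              pow_le_pow_left₀ (norm_nonneg _) (hP n x) 2
            have hAB : ‖A + B‖ ^ 2 ≤ (‖A‖ + ‖B‖) ^ 2 :=
              pow_le_pow_left₀ (norm_nonneg _) (norm_add_le _ _) 2
            nlinarith [sq_nonneg (‖A‖ - ‖B‖)]
        _ = _ + 2 * (((n : ℝ) + 1)⁻¹ * C) ^ 2 * ∫ x, ‖(ρ n ⋆ᵥ w) x‖ ^ 2 := by
            rw [integral_add (j1.const_mul 2) (j2.const_mul _), integral_const_mul,
              integral_const_mul]
        _ ≤ _ := add_le_add le_rfl (mul_le_mul_of_nonneg_left (hww n).2 (by positivity))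
    refine squeeze_zero (fun n => integral_nonneg fun x => by positivity) hbound ?_
    have h3 : Tendsto (fun n : ℕ => ((n : ℝ) + 1)⁻¹) atTop (𝓝 0) := by
      simpa using tendsto_one_div_add_atTop_nhds_zero_nat (𝕜 := ℝ)
    have := (ht1.const_mul 2).add
      ((((h3.mul_const C).pow 2).const_mul 2).mul_const (∫ x, ‖w x‖ ^ 2))
    simpa using this
  · rw [norm_smul]
    exact (mul_le_of_le_one_left (norm_nonneg _) (hZ1 n x)).trans
      (norm_convolution_le (hρ n) (hρc n) (hρ0 n) (hρ1 n) hM x)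

/-! ### Continuity of quadratic integrals under L² convergence -/

theorem integrable_norm_sq {h : R2 → R3} (hh : MemLp h 2) : Integrable fun x => ‖h x‖ ^ 2 :=
  hh.integrable_norm_pow (by norm_num)

theorem integrable_norm_mul_norm {a b : R2 → R3} (ha : MemLp a 2) (hb : MemLp b 2) :
    Integrable fun x => ‖a x‖ * ‖b x‖ :=
  ha.norm.integrable_mul hb.norm

theorem integral_norm_mul_norm_le {a b : R2 → R3} (ha : MemLp a 2) (hb : MemLp b 2) :
    ∫ x, ‖a x‖ * ‖b x‖ ≤ √(∫ x, ‖a x‖ ^ 2) * √(∫ x, ‖b x‖ ^ 2) := by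
  have := integral_mul_le_Lp_mul_Lq_of_nonneg (μ := volume) (f := fun x => ‖a x‖)
    (g := fun x => ‖b x‖) (p := 2) (q := 2) (Real.HolderConjugate.two_two)
    (Eventually.of_forall fun x => norm_nonneg _) (Eventually.of_forall fun x => norm_nonneg _)
    (by simpa using ha.norm) (by simpa using hb.norm)
  simpa [Real.sqrt_eq_rpow] using this

theorem tendsto_integral_norm_mul_norm {A B : ℕ → R2 → R3} {s t : ℝ}
    (hA : ∀ n, MemLp (A n) 2) (hB : ∀ n, MemLp (B n) 2)
    (tA : Tendsto (fun n => ∫ x, ‖A n x‖ ^ 2) atTop (𝓝 s))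
    (tB : Tendsto (fun n => ∫ x, ‖B n x‖ ^ 2) atTop (𝓝 t)) (hst : √s * √t = 0) :
    Tendsto (fun n => ∫ x, ‖A n x‖ * ‖B n x‖) atTop (𝓝 0) := by
  have := ((Real.continuous_sqrt.tendsto s).comp tA).mul ((Real.continuous_sqrt.tendsto t).comp tB)
  rw [hst] at this
  exact squeeze_zero (fun n => integral_nonneg fun x => by positivity)
    (fun n => integral_norm_mul_norm_le (hA n) (hB n)) this

section limits
variable {P Q : ℕ → R2 → R3} {p q : R2 → R3}

theorem aestronglyMeasurable_wedge {a b : R2 → R3} (ha : AEStronglyMeasurable a)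
    (hb : AEStronglyMeasurable b) : AEStronglyMeasurable fun x => wedge (a x) (b x) :=
  continuous_wedge.comp_aestronglyMeasurable (ha.prodMk hb)

theorem integrable_wedge {a b : R2 → R3} (ha : MemLp a 2) (hb : MemLp b 2) :
    Integrable fun x => wedge (a x) (b x) :=
  (integrable_norm_mul_norm ha hb).mono' (aestronglyMeasurable_wedge ha.1 hb.1)
    (Eventually.of_forall fun _ => norm_wedge_le _ _)

theorem tendsto_integral_norm_sq (hP : ∀ n, MemLp (P n) 2) (hp : MemLp p 2)
    (tP : Tendsto (fun n => ∫ x, ‖P n x - p x‖ ^ 2) atTop (𝓝 0)) :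
    Tendsto (fun n => ∫ x, ‖P n x‖ ^ 2) atTop (𝓝 (∫ x, ‖p x‖ ^ 2)) := by
  have hd n : MemLp (fun x => P n x - p x) 2 := (hP n).sub hp
  have t1 := tendsto_integral_norm_mul_norm hd (fun _ => hp) tP tendsto_const_nhds (by simp)
  rw [tendsto_iff_norm_sub_tendsto_zero]
  have ht := tP.add (t1.const_mul 2)
  rw [mul_zero, add_zero] at ht
  refine squeeze_zero (fun n => norm_nonneg _) (fun n => ?_) ht
  rw [← integral_sub (integrable_norm_sq (hP n)) (integrable_norm_sq hp), ← integral_const_mul,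
    ← integral_add (integrable_norm_sq (hd n)) ((integrable_norm_mul_norm (hd n) hp).const_mul 2)]
  refine norm_integral_le_of_norm_le ((integrable_norm_sq (hd n)).add
    ((integrable_norm_mul_norm (hd n) hp).const_mul 2)) (Eventually.of_forall fun x => ?_)
  rw [Real.norm_eq_abs, abs_le]
  have h1 := norm_le_norm_add_norm_sub' (P n x) (p x)
  have h2 := norm_le_norm_add_norm_sub (P n x) (p x)
  have h3 := norm_nonneg (P n x)
  have h4 := norm_nonneg (p x)
  have h5 := norm_nonneg (P n x - p x)
  constructor <;> nlinarith

/-- Changing one factor at a time leaves two products, each with a factor tending to zero in L² and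
the other bounded there; Cauchy–Schwarz concludes. -/
theorem tendsto_integral_wedge_sub (hP : ∀ n, MemLp (P n) 2) (hp : MemLp p 2)
    (hQ : ∀ n, MemLp (Q n) 2) (hq : MemLp q 2)
    (tP : Tendsto (fun n => ∫ x, ‖P n x - p x‖ ^ 2) atTop (𝓝 0))
    (tQ : Tendsto (fun n => ∫ x, ‖Q n x - q x‖ ^ 2) atTop (𝓝 0)) :
    Tendsto (fun n => ∫ x, ‖wedge (P n x) (Q n x) - wedge (p x) (q x)‖) atTop (𝓝 0) := by
  have dP n : MemLp (fun x => P n x - p x) 2 := (hP n).sub hp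
  have dQ n : MemLp (fun x => Q n x - q x) 2 := (hQ n).sub hq
  have t1 := tendsto_integral_norm_mul_norm dP hQ tP (tendsto_integral_norm_sq hQ hq tQ) (by simp)
  have t2 := tendsto_integral_norm_mul_norm (fun _ => hp) dQ tendsto_const_nhds tQ (by simp)
  have ht := t1.add t2
  rw [add_zero] at ht
  refine squeeze_zero (fun n => integral_nonneg fun x => norm_nonneg _) (fun n => ?_) ht
  have i1 := integrable_norm_mul_norm (dP n) (hQ n)
  have i2 := integrable_norm_mul_norm hp (dQ n)
  rw [← integral_add i1 i2]
  refine integral_mono_of_nonneg (Eventually.of_forall fun x => norm_nonneg _) (i1.add i2)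
    (Eventually.of_forall fun x => ?_)
  have : wedge (P n x) (Q n x) - wedge (p x) (q x) =
      wedge (P n x - p x) (Q n x) + wedge (p x) (Q n x - q x) := by
    rw [wedge_sub_left, wedge_sub_right]; abel
  dsimp only
  rw [this]
  exact (norm_add_le _ _).trans (add_le_add (norm_wedge_le _ _) (norm_wedge_le _ _))

theorem tendsto_integral_of_norm_sub {F : Type*} [NormedAddCommGroup F] [NormedSpace ℝ F]
    {h : ℕ → R2 → F} {g : R2 → F} (hh : ∀ n, Integrable (h n)) (hg : Integrable g)
    (ht : Tendsto (fun n => ∫ x, ‖h n x - g x‖) atTop (𝓝 0)) :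
    Tendsto (fun n => ∫ x, h n x) atTop (𝓝 (∫ x, g x)) := by
  rw [tendsto_iff_norm_sub_tendsto_zero]
  refine squeeze_zero (fun n => norm_nonneg _) (fun n => ?_) ht
  rw [← integral_sub (hh n) hg]
  exact norm_integral_le_integral_norm _

theorem tendsto_integral_norm_wedge (hP : ∀ n, MemLp (P n) 2) (hp : MemLp p 2)
    (hQ : ∀ n, MemLp (Q n) 2) (hq : MemLp q 2)
    (tP : Tendsto (fun n => ∫ x, ‖P n x - p x‖ ^ 2) atTop (𝓝 0))
    (tQ : Tendsto (fun n => ∫ x, ‖Q n x - q x‖ ^ 2) atTop (𝓝 0)) :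
    Tendsto (fun n => ∫ x, ‖wedge (P n x) (Q n x)‖) atTop (𝓝 (∫ x, ‖wedge (p x) (q x)‖)) := by
  refine tendsto_integral_of_norm_sub (fun n => (integrable_wedge (hP n) (hQ n)).norm)
    (integrable_wedge hp hq).norm ?_
  refine squeeze_zero (fun n => integral_nonneg fun x => norm_nonneg _) (fun n => ?_)
    (tendsto_integral_wedge_sub hP hp hQ hq tP tQ)
  refine integral_mono_of_nonneg (Eventually.of_forall fun x => norm_nonneg _)
    ((integrable_wedge (hP n) (hQ n)).sub (integrable_wedge hp hq)).norm
    (Eventually.of_forall fun x => ?_)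
  exact abs_norm_sub_norm_le _ _

theorem tendsto_integral_smul_wedge (hP : ∀ n, MemLp (P n) 2) (hp : MemLp p 2)
    (hQ : ∀ n, MemLp (Q n) 2) (hq : MemLp q 2)
    (tP : Tendsto (fun n => ∫ x, ‖P n x - p x‖ ^ 2) atTop (𝓝 0))
    (tQ : Tendsto (fun n => ∫ x, ‖Q n x - q x‖ ^ 2) atTop (𝓝 0))
    {φ : R2 → ℝ} (hφ : Continuous φ) {C : ℝ} (hC : ∀ x, ‖φ x‖ ≤ C) :
    Tendsto (fun n => ∫ x, φ x • wedge (P n x) (Q n x)) atTop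
      (𝓝 (∫ x, φ x • wedge (p x) (q x))) := by
  have hI {w : R2 → R3} (hw : Integrable w) : Integrable fun x => φ x • w x :=
    hw.bdd_smul C hφ.aestronglyMeasurable (Eventually.of_forall hC)
  refine tendsto_integral_of_norm_sub (fun n => hI (integrable_wedge (hP n) (hQ n)))
    (hI (integrable_wedge hp hq)) ?_
  have ht := (tendsto_integral_wedge_sub hP hp hQ hq tP tQ).const_mul C
  rw [mul_zero] at ht
  refine squeeze_zero (fun n => integral_nonneg fun x => norm_nonneg _) (fun n => ?_) ht
  rw [← integral_const_mul]
  refine integral_mono_of_nonneg (Eventually.of_forall fun x => norm_nonneg _)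
    (((integrable_wedge (hP n) (hQ n)).sub (integrable_wedge hp hq)).norm.const_mul C)
    (Eventually.of_forall fun x => ?_)
  dsimp only
  rw [← smul_sub, norm_smul]
  exact mul_le_mul_of_nonneg_right (hC x) (norm_nonneg _)

theorem tendsto_integral_inner (hP : ∀ n, MemLp (P n) 2) (hp : MemLp p 2)
    (tP : Tendsto (fun n => ∫ x, ‖P n x - p x‖ ^ 2) atTop (𝓝 0)) :
    Tendsto (fun n => ∫ x, inner ℝ (P n x) (p x)) atTop (𝓝 (∫ x, ‖p x‖ ^ 2)) := by
  have hd n : MemLp (fun x => P n x - p x) 2 := (hP n).sub hp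
  have hi n : Integrable fun x => inner ℝ (P n x) (p x) :=
    (integrable_norm_mul_norm (hP n) hp).mono' ((hP n).1.inner hp.1)
      (Eventually.of_forall fun x => norm_inner_le_norm _ _)
  have t1 := tendsto_integral_norm_mul_norm hd (fun _ => hp) tP tendsto_const_nhds (by simp)
  refine tendsto_integral_of_norm_sub hi (integrable_norm_sq hp) ?_
  refine squeeze_zero (fun n => integral_nonneg fun x => norm_nonneg _) (fun n => ?_) t1
  refine integral_mono_of_nonneg (Eventually.of_forall fun x => norm_nonneg _)
    (integrable_norm_mul_norm (hd n) hp) (Eventually.of_forall fun x => ?_)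
  dsimp only
  rw [← real_inner_self_eq_norm_sq, ← inner_sub_left]
  exact norm_inner_le_norm _ _

end limits

/-! ### The potential estimate in the Sobolev space -/

theorem memLp_of_contDiff {w : R2 → R3} (hw : ContDiff ℝ 1 w) (hc : HasCompactSupport w)
    (i : Fin 2) : MemLp (pd i w) 2 :=
  (hw.pd (m := 0) i (by simp)).continuous.memLp_of_hasCompactSupport (hc.pd i)

/-- The logarithmic potential estimate for the Jacobian of a map in `H¹`. -/
theorem MemH1.norm_integral_logKernel_jacobian_le {v : R2 → R3} (hv : MemH1 v) {a b : ℝ}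
    (ha : 0 < a) (hab : a ≤ b) (z : R2) :
    ‖∫ x, logKernel a b (‖x - z‖ ^ 2) • ((2 : ℝ) •
        wedge (weakPartial 0 v x) (weakPartial 1 v x))‖ ≤
      (2 * Real.pi)⁻¹ * ((∫ x, ‖weakPartial 0 v x‖ ^ 2) + ∫ x, ‖weakPartial 1 v x‖ ^ 2) ∧
    ‖∫ x, logKernel a b (‖x - z‖ ^ 2) • ((2 : ℝ) •
        wedge (weakPartial 0 v x) (weakPartial 1 v x))‖ ≤
      (2 * Real.pi)⁻¹ * (√3 * ((∫ x, ‖weakPartial 0 v x‖ ^ 2) + ∫ x, ‖weakPartial 1 v x‖ ^ 2) -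
        2 * ∫ x, ‖wedge (weakPartial 0 v x) (weakPartial 1 v x)‖) := by
  obtain ⟨W, hW, hWc, hWt, -⟩ := exists_smooth_approx hv.1 hv.hasWeakPartial hv.memLp_weakPartial
  have hW2 n : ContDiff ℝ 2 (W n) := by exact mod_cast contDiff_infty.1 (hW n) 2
  have hm i n : MemLp (pd i (W n)) 2 :=
    memLp_of_contDiff ((hW2 n).of_le (by norm_num)) (hWc n) i
  have hg := hv.memLp_weakPartial
  obtain ⟨hφs, hφc⟩ := isTest_logKernel ha hab z
  obtain ⟨C, hC⟩ := hφc.exists_bound_of_continuous hφs.continuous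
  have T0 := ((tendsto_integral_smul_wedge (hm 0) (hg 0) (hm 1) (hg 1) (hWt 0) (hWt 1)
    hφs.continuous hC).const_smul (2 : ℝ)).norm
  have T1 := tendsto_integral_norm_sq (hm 0) (hg 0) (hWt 0)
  have T2 := tendsto_integral_norm_sq (hm 1) (hg 1) (hWt 1)
  have T3 := tendsto_integral_norm_wedge (hm 0) (hg 0) (hm 1) (hg 1) (hWt 0) (hWt 1)
  have key n := norm_integral_radial_jacobian_le (contDiff_logKernel ha hab)
    (abs_mul_deriv_logKernel_le ha hab) (hW2 n) (hWc n) z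
  have e (n) : ∫ x, (‖pd 0 (W n) x‖ ^ 2 + ‖pd 1 (W n) x‖ ^ 2) =
      (∫ x, ‖pd 0 (W n) x‖ ^ 2) + ∫ x, ‖pd 1 (W n) x‖ ^ 2 :=
    integral_add (integrable_norm_sq (hm 0 n)) (integrable_norm_sq (hm 1 n))
  have e' (n) : ∫ x, (√3 * (‖pd 0 (W n) x‖ ^ 2 + ‖pd 1 (W n) x‖ ^ 2) -
      2 * ‖wedge (pd 0 (W n) x) (pd 1 (W n) x)‖) =
      √3 * ((∫ x, ‖pd 0 (W n) x‖ ^ 2) + ∫ x, ‖pd 1 (W n) x‖ ^ 2) -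
        2 * ∫ x, ‖wedge (pd 0 (W n) x) (pd 1 (W n) x)‖ := by
    have i1 : Integrable fun x => ‖pd 0 (W n) x‖ ^ 2 + ‖pd 1 (W n) x‖ ^ 2 :=
      (integrable_norm_sq (hm 0 n)).add (integrable_norm_sq (hm 1 n))
    rw [integral_sub (i1.const_mul _) ((integrable_wedge (hm 0 n) (hm 1 n)).norm.const_mul _),
      integral_const_mul, integral_const_mul, e]
  simp_rw [e, e', smul_comm _ (2 : ℝ), integral_smul] at key
  simp_rw [smul_comm _ (2 : ℝ), integral_smul]
  exact ⟨le_of_tendsto_of_tendsto' T0 ((T1.add T2).const_mul _) fun n => (key n).1,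
    le_of_tendsto_of_tendsto' T0 ((((T1.add T2).const_mul _).sub (T3.const_mul 2)).const_mul _)
      fun n => (key n).2⟩

/-! ### Sup bound and energy of solutions -/

section solution
variable {u v : R2 → R3}

theorem IsSolution.ae_norm_le (hv : MemH1 v) (hu : MemH1 u) (huv : IsSolution u v) :
    (∀ᵐ z, ‖u z‖ ≤ (2 * Real.pi)⁻¹ *
      ((∫ x, ‖weakPartial 0 v x‖ ^ 2) + ∫ x, ‖weakPartial 1 v x‖ ^ 2)) ∧
    ∀ᵐ z, ‖u z‖ ≤ (2 * Real.pi)⁻¹ *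
      (√3 * ((∫ x, ‖weakPartial 0 v x‖ ^ 2) + ∫ x, ‖weakPartial 1 v x‖ ^ 2) -
        2 * ∫ x, ‖wedge (weakPartial 0 v x) (weakPartial 1 v x)‖) := by
  have e (z : R2) (a b : ℝ) (ha : 0 < a) (hab : a ≤ b) :
      ‖∫ x, Laplacian.laplacian (fun x : R2 => logKernel a b (‖x - z‖ ^ 2)) x • u x‖ =
      ‖∫ x, logKernel a b (‖x - z‖ ^ 2) • ((2 : ℝ) •
        wedge (weakPartial 0 v x) (weakPartial 1 v x))‖ := by
    rw [huv _ (isTest_logKernel ha hab z)]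
    simp_rw [neg_smul, smul_neg, integral_neg, norm_neg]
  refine ⟨ae_norm_le_of_laplacian hu.1 fun z a b ha hab => ?_,
    ae_norm_le_of_laplacian hu.1 fun z a b ha hab => ?_⟩
  · rw [e z a b ha hab]; exact (hv.norm_integral_logKernel_jacobian_le ha hab z).1
  · rw [e z a b ha hab]; exact (hv.norm_integral_logKernel_jacobian_le ha hab z).2

/-- The weak equation tested with a scalar function, in divergence form. -/
theorem IsSolution.sum_integral_pd_smul (hu : MemH1 u) (huv : IsSolution u v) {φ : R2 → ℝ}
    (hφ : IsTest φ) :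
    ∑ i, ∫ x, pd i φ x • weakPartial i u x =
      ∫ x, φ x • ((2 : ℝ) • wedge (weakPartial 0 v x) (weakPartial 1 v x)) := by
  have ht (i) : IsTest (pd i φ) := ⟨hφ.1.pd i (by simp), hφ.2.pd i⟩
  have h2 : ContDiff ℝ 2 φ := by exact mod_cast contDiff_infty.1 hφ.1 2
  have h := huv φ hφ
  have hloc : LocallyIntegrable u := hu.1.locallyIntegrable (by norm_num)
  have hI (i) : Integrable fun x => pd i (pd i φ) x • u x :=
    hloc.integrable_smul_left_of_hasCompactSupport
      ((ht i).1.pd (m := 0) i (by simp)).continuous ((ht i).2.pd i)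
  simp_rw [laplacian_eq_sum_pd h2, Finset.sum_smul] at h
  rw [integral_finsetSum _ fun i _ => hI i] at h
  simp_rw [neg_smul, smul_neg, integral_neg] at h
  have h3 (i) : ∫ x, pd i (pd i φ) x • u x = -∫ x, pd i φ x • weakPartial i u x :=
    (hu.hasWeakPartial i).2.2 _ (ht i)
  simp_rw [h3, Finset.sum_neg_distrib] at h
  exact neg_injective h

/-- The weak equation tested with a vector valued function. -/
theorem IsSolution.sum_integral_inner (hv : MemH1 v) (hu : MemH1 u) (huv : IsSolution u v)
    {w : R2 → R3} (hw : ContDiff ℝ ∞ w) (hc : HasCompactSupport w) :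
    ∑ i, ∫ x, inner ℝ (pd i w x) (weakPartial i u x) =
      ∫ x, inner ℝ (w x) ((2 : ℝ) • wedge (weakPartial 0 v x) (weakPartial 1 v x)) := by
  have hg := hu.memLp_weakPartial
  have hf : Integrable fun x => (2 : ℝ) • wedge (weakPartial 0 v x) (weakPartial 1 v x) :=
    (integrable_wedge (hv.memLp_weakPartial 0) (hv.memLp_weakPartial 1)).smul (2 : ℝ)
  have hwj (j : Fin 3) : IsTest fun x => w x j :=
    ⟨by fun_prop, hc.comp_left (g := fun y : R3 => y j) rfl⟩
  have hsm {h : R2 → ℝ} {g : R2 → R3} (hh : IsTest h) (hg : LocallyIntegrable g) :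
      Integrable fun x => h x • g x :=
    hg.integrable_smul_left_of_hasCompactSupport hh.1.continuous hh.2
  have ht (i j) : IsTest (pd i fun x => w x j) := ⟨(hwj j).1.pd i (by simp), (hwj j).2.pd i⟩
  have hpd (i j x) : pd i (fun x => w x j) x = pd i w x j := by
    have h1 := ((EuclideanSpace.proj (𝕜 := ℝ) j).hasFDerivAt.comp x
      (hw.differentiable (by simp) x).hasFDerivAt).fderiv
    change fderiv ℝ (fun x => w x j) x = _ at h1
    rw [pd, h1]
    rfl
  have hcoord {h : R2 → ℝ} {g : R2 → R3} (j : Fin 3) (hi : Integrable fun x => h x • g x) :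
      (∫ x, h x • g x) j = ∫ x, h x * g x j := by
    have := (EuclideanSpace.proj (𝕜 := ℝ) j).integral_comp_comm hi
    simpa using this.symm
  have hci {h : R2 → ℝ} {g : R2 → R3} (j : Fin 3) (hi : Integrable fun x => h x • g x) :
      Integrable fun x => h x * g x j := by
    have := (EuclideanSpace.proj (𝕜 := ℝ) j).integrable_comp hi
    simpa using this
  have hin (a b : R3) : inner ℝ a b = ∑ j, a j * b j := by
    simp [PiLp.inner_apply, mul_comm]
  have hgl (i) : LocallyIntegrable (weakPartial i u) := (hu.hasWeakPartial i).2.1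
  -- For each j, the scalar test function w_j is used in the vector equation and only the j-th
  -- component is kept; summing over j gives the inner products.
  have key (j : Fin 3) := congrArg (fun y : R3 => y j) (huv.sum_integral_pd_smul hu (hwj j))
  simp only [WithLp.ofLp_sum, Finset.sum_apply] at key
  simp_rw [hin]
  have l (i : Fin 2) : ∫ x, ∑ j, pd i w x j * weakPartial i u x j =
      ∑ j, ∫ x, pd i w x j * weakPartial i u x j :=
    integral_finsetSum _ fun j _ => by
      have := hci j (hsm (ht i j) (hgl i))
      simpa only [hpd] using this
  rw [integral_finsetSum _ fun j _ => hci j (hsm (hwj j) hf.locallyIntegrable)]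
  simp_rw [l]
  rw [Finset.sum_comm]
  refine Finset.sum_congr rfl fun j _ => ?_
  rw [← hcoord j (hsm (hwj j) hf.locallyIntegrable), ← key j]
  refine Finset.sum_congr rfl fun i _ => ?_
  rw [hcoord j (hsm (ht i j) (hgl i))]
  simp_rw [hpd]

/-- Formally this is the equation tested with u. The right-hand side is only in L¹, so the
approximating test maps must obey the same sup bound M as u. -/
theorem IsSolution.energy_le (hv : MemH1 v) (hu : MemH1 u) (huv : IsSolution u v) {M : ℝ}
    (hM : ∀ᵐ z, ‖u z‖ ≤ M) :
    (∫ x, ‖weakPartial 0 u x‖ ^ 2) + ∫ x, ‖weakPartial 1 u x‖ ^ 2 ≤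
      M * (2 * ∫ x, ‖wedge (weakPartial 0 v x) (weakPartial 1 v x)‖) := by
  obtain ⟨W, hW, hWc, hWt, hWM⟩ := exists_smooth_approx hu.1 hu.hasWeakPartial hu.memLp_weakPartial
  have hm i n : MemLp (pd i (W n)) 2 :=
    memLp_of_contDiff ((hW n).of_le (by exact_mod_cast le_top)) (hWc n) i
  have T i := tendsto_integral_inner (hm i) (hu.memLp_weakPartial i) (hWt i)
  have hf := integrable_wedge (hv.memLp_weakPartial 0) (hv.memLp_weakPartial 1)
  refine le_of_tendsto' ((T 0).add (T 1)) fun n => ?_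
  have h := huv.sum_integral_inner hv hu (hW n) (hWc n)
  rw [Fin.sum_univ_two] at h
  rw [h, ← integral_const_mul, ← integral_const_mul]
  refine (Real.le_norm_self _).trans (norm_integral_le_of_norm_le ((hf.norm.const_mul 2).const_mul M)
    (Eventually.of_forall fun x => ?_))
  refine (norm_inner_le_norm _ _).trans ?_
  rw [norm_smul, Real.norm_of_nonneg (by norm_num : (0 : ℝ) ≤ 2)]
  exact mul_le_mul_of_nonneg_right (hWM M hM n x) (by positivity)

end solution

/-! ### Oscillation, gradient norm and conclusion -/

theorem eLpNorm_gradNorm {u : R2 → R3} (hu : MemH1 u) :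
    eLpNorm (gradNorm u) 2 volume =
      ENNReal.ofReal √((∫ x, ‖weakPartial 0 u x‖ ^ 2) + ∫ x, ‖weakPartial 1 u x‖ ^ 2) := by
  have h0 := hu.memLp_weakPartial 0
  have h1 := hu.memLp_weakPartial 1
  have i0 := integrable_norm_sq h0
  have i1 := integrable_norm_sq h1
  have hmeas : AEStronglyMeasurable (gradNorm u) :=
    Real.continuous_sqrt.comp_aestronglyMeasurable
      ((h0.1.norm.pow 2).add (h1.1.norm.pow 2))
  have hsq (x) : ‖gradNorm u x‖ ^ 2 = ‖weakPartial 0 u x‖ ^ 2 + ‖weakPartial 1 u x‖ ^ 2 := by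
    rw [gradNorm, Real.norm_of_nonneg (Real.sqrt_nonneg _), Real.sq_sqrt (by positivity)]
  have hmem : MemLp (gradNorm u) 2 := by
    rw [memLp_two_iff_integrable_sq_norm hmeas]
    simp_rw [hsq]
    exact i0.add i1
  rw [hmem.eLpNorm_eq_integral_rpow_norm (by norm_num) (by norm_num)]
  simp only [ENNReal.toReal_ofNat, Real.rpow_ofNat, hsq]
  rw [integral_add i0 i1, Real.sqrt_eq_rpow, one_div]

theorem osc_le {u : R2 → R3} {M : ℝ} (hM : ∀ᵐ z, ‖u z‖ ≤ M) : osc u ≤ ENNReal.ofReal (2 * M) := by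
  refine essSup_le_of_ae_le _ ?_
  filter_upwards [Measure.quasiMeasurePreserving_fst.ae hM,
    Measure.quasiMeasurePreserving_snd.ae hM] with p h1 h2
  rw [← ofReal_norm]
  refine ENNReal.ofReal_le_ofReal ?_
  exact (norm_sub_le _ _).trans (by linarith)

/-- Wente's inequality for the oscillation and the energy of a solution. -/
theorem IsSolution.osc_add_eLpNorm_gradNorm_le {u v : R2 → R3} (hv : MemH1 v) (hu : MemH1 u)
    (huv : IsSolution u v) :
    osc u + eLpNorm (gradNorm u) 2 volume ≤
      ENNReal.ofReal (1 / Real.pi + √(3 / (8 * Real.pi))) *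
        eLpNorm (gradNorm v) 2 volume ^ 2 := by
  have hpi := Real.pi_pos
  obtain ⟨b1, b2⟩ := huv.ae_norm_le hv hu
  -- The energy uses the bound containing Q; the oscillation uses the other one, which has the
  -- better constant in front of D.
  have hE := huv.energy_le hv hu b2
  have ho := osc_le b1
  rw [eLpNorm_gradNorm hu, eLpNorm_gradNorm hv]
  set D := (∫ x, ‖weakPartial 0 v x‖ ^ 2) + ∫ x, ‖weakPartial 1 v x‖ ^ 2
  set Q := ∫ x, ‖wedge (weakPartial 0 v x) (weakPartial 1 v x)‖
  have hD : 0 ≤ D := add_nonneg (integral_nonneg fun x => by positivity)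
    (integral_nonneg fun x => by positivity)
  have hgrad : √((∫ x, ‖weakPartial 0 u x‖ ^ 2) + ∫ x, ‖weakPartial 1 u x‖ ^ 2) ≤
      √(3 / (8 * Real.pi)) * D := by
    have h3 : √3 * √3 = 3 := Real.mul_self_sqrt (by norm_num)
    rw [← Real.sqrt_sq hD, ← Real.sqrt_mul (by positivity)]
    refine Real.sqrt_le_sqrt (hE.trans ?_)
    -- As a function of 2Q the product is largest at 2Q = √3 D/2; the deficit is (√3 D - 4Q)²/4.
    have : (√3 * D - 2 * Q) * (2 * Q) ≤ 3 / 4 * D ^ 2 := by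
      nlinarith [sq_nonneg (√3 * D - 4 * Q)]
    calc (2 * Real.pi)⁻¹ * (√3 * D - 2 * Q) * (2 * Q)
        = (2 * Real.pi)⁻¹ * ((√3 * D - 2 * Q) * (2 * Q)) := by ring
      _ ≤ (2 * Real.pi)⁻¹ * (3 / 4 * D ^ 2) := by gcongr
      _ = 3 / (8 * Real.pi) * D ^ 2 := by field_simp; ring
  rw [← ENNReal.ofReal_pow (Real.sqrt_nonneg _), Real.sq_sqrt hD,
    ← ENNReal.ofReal_mul (by positivity), add_mul, ENNReal.ofReal_add (by positivity)
    (by positivity)]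
  refine add_le_add (ho.trans (ENNReal.ofReal_le_ofReal (le_of_eq ?_)))
    (ENNReal.ofReal_le_ofReal hgrad)
  field_simp

end Wente

theorem mainTheorem5 (v u : Wente.R2 → Wente.R3) (hv : Wente.MemH1 v) (hu : Wente.MemH1 u)
    (huv : Wente.IsSolution u v) :
    Wente.osc u + eLpNorm (Wente.gradNorm u) 2 volume ≤
      ENNReal.ofReal (1 / Real.pi + √(3 / (8 * Real.pi))) *
        eLpNorm (Wente.gradNorm v) 2 volume ^ 2 :=
  huv.osc_add_eLpNorm_gradNorm_le hv hu
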